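/- Let $K$ be a field and let $A$ be a finite-dimensional $K$-algebra. Modules are finite-dimensional right $A$-modules unless stated otherwise, and $D=\operatorname{Hom}_K(-,K)$ is the duality between right and left $A$-modules. The dominant dimension of a (right or left) module $M$ with minimal injective resolution $0\to M\to I_0\to I_1\to\cdots$ is the supremum in $\{0,1,2,\dots,\infty\}$ of all $n\ge 0$ such that $I_0,\dots,I_{n-1}$ are projective; the codominant dimension of a right module $M$ is the dominant dimension of the left module $D(M)$. The module $M$ is called Gorenstein projective if $\operatorname{Ext}^i_A(M,A)=0=\operatorname{Ext}^i_A(\operatorname{Tr}(M),A)$ for all $i\ge 1$, where $\operatorname{Tr}(M)$ is the cokernel of $\operatorname{Hom}_A(P_0,A)\to\operatorname{Hom}_A(P_1,A)$ for a minimal projective presentation $P_1\to P_0\to M\to 0$, and similarly for left modules; a right module $M$ is called Gorenstein injective if the left module $D(M)$ is Gorenstein projective, and Gorenstein projective-injective if it is both Gorenstein projective and Gorenstein injective. Assume that $A$ is gendo-symmetric, that is, the right module $A_A$ has dominant dimension at least $2$ and there is an idempotent $e\in A$ such that $eA$ is a minimal faithful projective-injective right $A$-module (faithful, projective, injective, and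 a direct summand of every faithful right $A$-module) and $D(Ae)\cong eA$ as $(eAe,A)$-bimodules. Then for every finite-dimensional right $A$-module $M$ the following are equivalent: 1. $M$ is Gorenstein projective-injective. 2. $M$ has infinite dominant dimension and infinite codominant dimension. -/

import Mathlib

open MulOpposite CategoryTheory

universe u

/-! Modules over a ring `R` are left `R`-modules; right `A`-modules are `Aᵐᵒᵖ`-modules. -/

/-- A minimal injective resolution `0 → M → I 0 → I 1 → ⋯`: an exact sequence with injective terms
in which the image of each map is an essential submodule of its target. -/
structure MinimalInjectiveResolution (R : Type u) [Ring R] (M : Type u) [AddCommGroup M]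
    [Module R M] where
  I : ℕ → Type u
  [addCommGroup : ∀ n, AddCommGroup (I n)]
  [module : ∀ n, Module R (I n)]
  injective : ∀ n, Module.Injective R (I n)
  ι : M →ₗ[R] I 0
  d : ∀ n, I n →ₗ[R] I (n + 1)
  ι_injective : Function.Injective ι
  exact_zero : Function.Exact ι (d 0)
  exact_succ : ∀ n, Function.Exact (d n) (d (n + 1))
  essential_zero : ∀ N : Submodule R (I 0), N ⊓ LinearMap.range ι = ⊥ → N = ⊥
  essential_succ : ∀ n, ∀ N : Submodule R (I (n + 1)), N ⊓ LinearMap.range (d n) = ⊥ → N = ⊥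

attribute [instance] MinimalInjectiveResolution.addCommGroup MinimalInjectiveResolution.module

/-- The dominant dimension of `M`: the supremum of all `n` such that the terms `I 0, …, I (n - 1)`
of a minimal injective resolution of `M` are projective. (Minimal injective resolutions exist and
are unique up to isomorphism.) -/
noncomputable def dominantDimension (R : Type u) [Ring R] (M : Type u) [AddCommGroup M]
    [Module R M] : ℕ∞ :=
  sSup {k : ℕ∞ | ∃ n : ℕ, k = n ∧
    ∃ J : MinimalInjectiveResolution R M, ∀ i < n, Module.Projective R (J.I i)}

/-- The `K`-dual `D(M) = Hom_K(M, K)` of a right `A`-module `M`. -/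
def KDual (K A M : Type u) [Field K] [Ring A] [Algebra K A] [AddCommGroup M] [Module K M]
    [Module Aᵐᵒᵖ M] [IsScalarTower K Aᵐᵒᵖ M] : Type u :=
  M →ₗ[K] K

section KDual

variable (K A M : Type u) [Field K] [Ring A] [Algebra K A] [AddCommGroup M] [Module K M]
  [Module Aᵐᵒᵖ M] [IsScalarTower K Aᵐᵒᵖ M]

instance : AddCommGroup (KDual K A M) :=
  inferInstanceAs (AddCommGroup (M →ₗ[K] K))

/-- `D(M)` is a left `A`-module through `(a f)(m) = f(m a)`. -/
instance : Module A (KDual K A M) where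
  smul a f := LinearMap.comp (show M →ₗ[K] K from f) (Algebra.lsmul K K M (op a))
  one_smul f := LinearMap.ext fun m => congrArg (show M →ₗ[K] K from f) (one_smul Aᵐᵒᵖ m)
  mul_smul a b f := LinearMap.ext fun m =>
    congrArg (show M →ₗ[K] K from f) (mul_smul (op b) (op a) m)
  smul_zero _ := LinearMap.ext fun _ => rfl
  smul_add _ _ _ := LinearMap.ext fun _ => rfl
  add_smul a b f := LinearMap.ext fun m =>
    (congrArg (show M →ₗ[K] K from f) (add_smul (op a) (op b) m)).trans (map_add _ _ _)
  zero_smul f := LinearMap.ext fun m =>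
    (congrArg (show M →ₗ[K] K from f) (zero_smul Aᵐᵒᵖ m)).trans (map_zero _)

end KDual

/-- The codominant dimension of a right `A`-module `M`: the dominant dimension of `D(M)`. -/
noncomputable def codominantDimension (K A M : Type u) [Field K] [Ring A] [Algebra K A]
    [AddCommGroup M] [Module K M] [Module Aᵐᵒᵖ M] [IsScalarTower K Aᵐᵒᵖ M] : ℕ∞ :=
  dominantDimension A (KDual K A M)

/-- A minimal projective presentation `P₁ → P₀ → M → 0`: an exact sequence in which `P₀ → M` and
`P₁ → ker (P₀ → M)` are projective covers, i.e. surjections from projective modules whose kernels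
are superfluous. -/
structure MinimalProjectivePresentation (R : Type u) [Ring R] (M : Type u) [AddCommGroup M]
    [Module R M] where
  P₀ : Type u
  P₁ : Type u
  [addCommGroup₀ : AddCommGroup P₀]
  [addCommGroup₁ : AddCommGroup P₁]
  [module₀ : Module R P₀]
  [module₁ : Module R P₁]
  projective₀ : Module.Projective R P₀
  projective₁ : Module.Projective R P₁
  π : P₀ →ₗ[R] M
  d : P₁ →ₗ[R] P₀
  π_surjective : Function.Surjective π
  exact : Function.Exact d π
  superfluous₀ : ∀ N : Submodule R P₀, N ⊔ LinearMap.ker π = ⊤ → N = ⊤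
  superfluous₁ : ∀ N : Submodule R P₁, N ⊔ LinearMap.ker d = ⊤ → N = ⊤

attribute [instance] MinimalProjectivePresentation.addCommGroup₀
  MinimalProjectivePresentation.addCommGroup₁ MinimalProjectivePresentation.module₀
  MinimalProjectivePresentation.module₁

section Transpose

variable {R : Type u} (S T : Type u) [Ring R] [Ring S] [AddCommGroup T] [Module R T] [Module S T]
  [SMulCommClass R S T] {M : Type u} [AddCommGroup M] [Module R M]

/-- For `d : P₁ → P₀`, the map `Hom_R(d, T) : Hom_R(P₀, T) → Hom_R(P₁, T)`, `φ ↦ φ ∘ d`, which is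
`S`-linear for the action of `S` on `T`. -/
def MinimalProjectivePresentation.dualMap (X : MinimalProjectivePresentation R M) :
    (X.P₀ →ₗ[R] T) →ₗ[S] (X.P₁ →ₗ[R] T) where
  toFun φ := φ ∘ₗ X.d
  map_add' _ _ := rfl
  map_smul' _ _ := rfl

/-- The transpose `Tr(M)`, the cokernel of `Hom_R(P₀, T) → Hom_R(P₁, T)`, computed from a minimal
projective presentation of `M`. Here `T` is the regular bimodule of an algebra `A`, and either
`R = Aᵐᵒᵖ`, `S = A` (for right modules `M`) or `R = A`, `S = Aᵐᵒᵖ` (for left modules `M`). -/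
abbrev MinimalProjectivePresentation.Transpose (X : MinimalProjectivePresentation R M) : Type u :=
  (X.P₁ →ₗ[R] T) ⧸ LinearMap.range (X.dualMap S T)

end Transpose

/-- `Ext_R^i(M, N) = 0` for all `i ≥ 1`. -/
def ExtVanishes (R M N : Type u) [Ring R] [AddCommGroup M] [Module R M] [AddCommGroup N]
    [Module R N] : Prop :=
  ∀ i : ℕ, 1 ≤ i → Subsingleton (Abelian.Ext.{u} (ModuleCat.of R M) (ModuleCat.of R N) i)

/-- A right `A`-module `M` is Gorenstein projective if `Ext^i(M, A) = 0 = Ext^i(Tr(M), A)` for all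
`i ≥ 1`, where `Tr(M)` is a left `A`-module. -/
def IsGorensteinProjective (A M : Type u) [Ring A] [AddCommGroup M] [Module Aᵐᵒᵖ M] : Prop :=
  ExtVanishes Aᵐᵒᵖ M A ∧
    ∃ X : MinimalProjectivePresentation Aᵐᵒᵖ M, ExtVanishes A (X.Transpose A A) A

/-- The same notion for a left `A`-module `M`; now `Tr(M)` is a right `A`-module. -/
def IsLeftGorensteinProjective (A M : Type u) [Ring A] [AddCommGroup M] [Module A M] : Prop :=
  ExtVanishes A M A ∧
    ∃ X : MinimalProjectivePresentation A M, ExtVanishes Aᵐᵒᵖ (X.Transpose Aᵐᵒᵖ A) A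

/-- A right `A`-module `M` is Gorenstein injective if the left `A`-module `D(M)` is Gorenstein
projective. -/
def IsGorensteinInjective (K A M : Type u) [Field K] [Ring A] [Algebra K A]
    [AddCommGroup M] [Module K M] [Module Aᵐᵒᵖ M] [IsScalarTower K Aᵐᵒᵖ M] : Prop :=
  IsLeftGorensteinProjective A (KDual K A M)

/-- A right `A`-module is Gorenstein projective-injective if it is Gorenstein projective and
Gorenstein injective. -/
def IsGorensteinProjectiveInjective (K A M : Type u) [Field K] [Ring A] [Algebra K A]
    [AddCommGroup M] [Module K M] [Module Aᵐᵒᵖ M] [IsScalarTower K Aᵐᵒᵖ M] : Prop :=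
  IsGorensteinProjective A M ∧ IsGorensteinInjective K A M

section GendoSymmetric

/-- The left ideal `A e`. -/
abbrev leftIdeal {A : Type u} [Ring A] (e : A) : Submodule A A :=
  Submodule.span A {e}

/-- The right ideal `e A`. -/
abbrev rightIdeal {A : Type u} [Ring A] (e : A) : Submodule Aᵐᵒᵖ A :=
  Submodule.span Aᵐᵒᵖ {e}

/-- `e` is an idempotent such that `e A` is a minimal faithful projective-injective right
`A`-module: it is faithful, projective and injective, and a direct summand of every finitely
generated faithful right `A`-module. -/
structure IsMinimalFaithfulProjInj {A : Type u} [Ring A] (e : A) : Prop where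
  idempotent : IsIdempotentElem e
  projective : Module.Projective Aᵐᵒᵖ (rightIdeal e)
  injective : Module.Injective Aᵐᵒᵖ (rightIdeal e)
  faithful : FaithfulSMul Aᵐᵒᵖ (rightIdeal e)
  minimal : ∀ (N : Type u) [AddCommGroup N] [Module Aᵐᵒᵖ N] [Module.Finite Aᵐᵒᵖ N]
    [FaithfulSMul Aᵐᵒᵖ N], ∃ (i : rightIdeal e →ₗ[Aᵐᵒᵖ] N) (p : N →ₗ[Aᵐᵒᵖ] rightIdeal e),
      p ∘ₗ i = LinearMap.id

variable (K : Type u) {A : Type u} [Field K] [Ring A] [Algebra K A]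

/-- Right multiplication `A e → A e`, `x ↦ x (e a e)` by an element of `e A e`. -/
def mulRightCorner (e a : A) : leftIdeal e →ₗ[K] leftIdeal e where
  toFun x := ⟨x * (e * a * e), Submodule.mem_span_singleton.2 ⟨x * (e * a), by
    simp [mul_assoc]⟩⟩
  map_add' x y := Subtype.ext (by simp [add_mul])
  map_smul' c x := Subtype.ext (by simp)

/-- An isomorphism `D(A e) ≅ e A` of `(e A e, A)`-bimodules. The actions on `D(A e)` are
`(f a)(x) = f(a x)` for `a ∈ A` and `(b f)(x) = f(x b)` for `b = e a e ∈ e A e`. -/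
structure DualBimoduleIso (e : A) where
  toEquiv : (leftIdeal e →ₗ[K] K) ≃ₗ[K] rightIdeal e
  map_right : ∀ (f : leftIdeal e →ₗ[K] K) (a : A),
    (toEquiv (f ∘ₗ Algebra.lsmul K K (leftIdeal e) a) : A) = toEquiv f * a
  map_left : ∀ (f : leftIdeal e →ₗ[K] K) (a : A),
    (toEquiv (f ∘ₗ mulRightCorner K e a) : A) = (e * a * e) * toEquiv f

variable (A)

/-- `A` is gendo-symmetric if the right module `A` has dominant dimension at least two and
`D(A e) ≅ e A` as `(e A e, A)`-bimodules, where `e A` is the minimal faithful projective-injective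
right `A`-module. -/
structure IsGendoSymmetric : Prop where
  two_le_dominantDimension : 2 ≤ dominantDimension Aᵐᵒᵖ A
  exists_iso : ∃ e : A, IsMinimalFaithfulProjInj e ∧ Nonempty (DualBimoduleIso K e)

end GendoSymmetric

/-!
The isomorphism `D(Ae) ≅ eA` gives a trace form on `A` that is symmetric on `eAe`. Dominant
dimension at least two gives `A ≅ Hom_{eAe}(Ae, Ae)`, so the form produces a bimodule homomorphism
`ω : D(A) → A` such that every left linear map `D(A) → A` is a unique right multiple of `ω`.

Composition with `ω` gives a natural map `M → Hom_A(D(M), A)`, which is bijective for projective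
`M`. Embedding `M`, and then successive cokernels, into projective-injective modules shows that `M`
has infinite dominant dimension exactly if this map is bijective and `Ext^i(D(M), A) = 0` for all
`i ≥ 1`. The adjoint of `ω` gives the same criterion for `D(M)`.

If `M` and `D(M)` are Gorenstein projective, both `Ext` conditions hold by definition. Both maps are
bijective because `M` and `D(M)` are reflexive and the map is bijective for every dual
`Hom_A(N, A)`. Conversely, bijectivity for `D(M)` identifies `D(M)` with `Hom_A(M, A)`, and
bijectivity for `M` then makes `M` reflexive.
-/

section Ext

variable {R : Type u} [Ring R] {Y P M N : Type u} [AddCommGroup Y] [AddCommGroup P]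
  [AddCommGroup M] [AddCommGroup N] [Module R Y] [Module R P] [Module R M] [Module R N]

theorem subsingleton_ext_one_iff [Module.Projective R P] {i : Y →ₗ[R] P} {p : P →ₗ[R] M}
    (hi : Function.Injective i) (hp : Function.Surjective p) (hip : Function.Exact i p) :
    Subsingleton (Abelian.Ext.{u} (ModuleCat.of R M) (ModuleCat.of R N) 1) ↔
      ∀ f : Y →ₗ[R] N, ∃ g : P →ₗ[R] N, g ∘ₗ i = f := by
  let C := ModuleCat.shortComplexOfCompEqZero i p hip.linearMap_comp_eq_zero
  have hC : C.ShortExact := ModuleCat.shortComplex_shortExact C hip hi hp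
  have : CategoryTheory.Projective C.X₂ :=
    (IsProjective.iff_projective (R := R) P).1 inferInstance
  constructor
  · intro _ f
    obtain ⟨x, hx⟩ := Abelian.Ext.contravariant_sequence_exact₁ hC (ModuleCat.of R N)
      (Abelian.Ext.mk₀ (ModuleCat.ofHom f)) (add_zero 1) (Subsingleton.elim _ _)
    obtain ⟨g, rfl⟩ := Abelian.Ext.addEquiv₀.symm.surjective x
    rw [Abelian.Ext.addEquiv₀_symm_apply, Abelian.Ext.mk₀_comp_mk₀] at hx
    have hg : C.f ≫ g = ModuleCat.ofHom f := (Abelian.Ext.mk₀_bijective _ _).1 hx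
    exact ⟨g.hom, congrArg ModuleCat.Hom.hom hg⟩
  · intro h
    refine subsingleton_of_forall_eq 0 fun x => ?_
    obtain ⟨y, rfl⟩ := Abelian.Ext.contravariant_sequence_exact₃ hC (ModuleCat.of R N) x
      (Abelian.Ext.eq_zero_of_projective _) (add_zero 1)
    obtain ⟨f, rfl⟩ := Abelian.Ext.addEquiv₀.symm.surjective y
    obtain ⟨g, hg⟩ := h f.hom
    have hf : f = C.f ≫ ModuleCat.ofHom g := ModuleCat.hom_ext hg.symm
    rw [Abelian.Ext.addEquiv₀_symm_apply, hf, ← Abelian.Ext.mk₀_comp_mk₀,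
      hC.extClass_comp_assoc]

theorem subsingleton_ext_succ_iff [Module.Projective R P] {i : Y →ₗ[R] P} {p : P →ₗ[R] M}
    (hi : Function.Injective i) (hp : Function.Surjective p) (hip : Function.Exact i p) (n : ℕ) :
    Subsingleton (Abelian.Ext.{u} (ModuleCat.of R M) (ModuleCat.of R N) (n + 2)) ↔
      Subsingleton (Abelian.Ext.{u} (ModuleCat.of R Y) (ModuleCat.of R N) (n + 1)) := by
  let C := ModuleCat.shortComplexOfCompEqZero i p hip.linearMap_comp_eq_zero
  have hC : C.ShortExact := ModuleCat.shortComplex_shortExact C hip hi hp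
  have : CategoryTheory.Projective C.X₂ :=
    (IsProjective.iff_projective (R := R) P).1 inferInstance
  have hn : 1 + (n + 1) = n + 2 := by lia
  constructor <;> refine fun _ => subsingleton_of_forall_eq 0 fun x => ?_
  · obtain ⟨y, rfl⟩ := Abelian.Ext.contravariant_sequence_exact₁ hC (ModuleCat.of R N) x hn
      (Subsingleton.elim _ _)
    rw [Abelian.Ext.eq_zero_of_projective y, Abelian.Ext.comp_zero]
  · obtain ⟨y, rfl⟩ := Abelian.Ext.contravariant_sequence_exact₃ hC (ModuleCat.of R N) x
      (Abelian.Ext.eq_zero_of_projective _) hn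
    rw [Subsingleton.elim y 0, Abelian.Ext.comp_zero]

theorem extVanishes_iff_of_exact [Module.Projective R P] {i : Y →ₗ[R] P} {p : P →ₗ[R] M}
    (hi : Function.Injective i) (hp : Function.Surjective p) (hip : Function.Exact i p) :
    ExtVanishes R M N ↔
      (∀ f : Y →ₗ[R] N, ∃ g : P →ₗ[R] N, g ∘ₗ i = f) ∧ ExtVanishes R Y N := by
  rw [← subsingleton_ext_one_iff hi hp hip]
  constructor
  · refine fun h => ⟨h 1 le_rfl, fun n hn => ?_⟩
    obtain ⟨n, rfl⟩ := Nat.exists_eq_add_of_le' hn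
    exact (subsingleton_ext_succ_iff hi hp hip n).1 (h _ (by lia))
  · rintro ⟨h₁, h⟩ n hn
    obtain ⟨n, rfl⟩ := Nat.exists_eq_add_of_le' hn
    cases n with
    | zero => exact h₁
    | succ n => exact (subsingleton_ext_succ_iff hi hp hip n).2 (h _ (by lia))

theorem ExtVanishes.of_linearEquiv (f : M ≃ₗ[R] Y) (h : ExtVanishes R M N) : ExtVanishes R Y N :=
  fun n hn =>
    let e : Abelian.Ext.{u} (ModuleCat.of R M) (ModuleCat.of R N) n ≃+
        Abelian.Ext.{u} (ModuleCat.of R Y) (ModuleCat.of R N) n :=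
      (((Abelian.extFunctor n).mapIso f.symm.toModuleIso.op).app
        (ModuleCat.of R N)).addCommGroupIsoToAddEquiv
    e.symm.subsingleton_congr.2 (h n hn)

end Ext

section Minimality

variable {R : Type u} [Ring R] {E X M : Type u} [AddCommGroup E] [AddCommGroup X] [AddCommGroup M]
  [Module R E] [Module R X] [Module R M]

/-- `N` is an essential submodule: it meets every nonzero submodule. The conditions on the maps of
a `MinimalInjectiveResolution` say that their ranges are essential. -/
def IsEssential (N : Submodule R E) : Prop :=
  ∀ L : Submodule R E, L ⊓ N = ⊥ → L = ⊥

/-- `N` is a superfluous submodule: it has no proper supplement. The conditions on the maps of a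
`MinimalProjectivePresentation` say that their kernels are superfluous. -/
def IsSuperfluous (N : Submodule R E) : Prop :=
  ∀ L : Submodule R E, L ⊔ N = ⊤ → L = ⊤

theorem injective_of_retract [hE : Module.Injective R E] (i : X →ₗ[R] E) (p : E →ₗ[R] X)
    (h : p ∘ₗ i = LinearMap.id) : Module.Injective R X where
  out _ _ _ _ _ _ f hf g := by
    obtain ⟨k, hk⟩ := hE.out f hf (i ∘ₗ g)
    exact ⟨p ∘ₗ k, fun x => by
      rw [LinearMap.comp_apply, hk]
      exact LinearMap.congr_fun h (g x)⟩

-- The quotient by a maximal submodule avoiding the range of `f`.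
theorem exists_mkQ_essential [IsNoetherian R E] {f : X →ₗ[R] E} (hf : Function.Injective f) :
    ∃ L : Submodule R E, Function.Injective (L.mkQ ∘ₗ f) ∧
      IsEssential (LinearMap.range (L.mkQ ∘ₗ f)) := by
  obtain ⟨L, hL, hmax⟩ := exists_maximal_of_wellFoundedGT
    (fun L : Submodule R E => L ⊓ LinearMap.range f = ⊥) ⟨⊥, bot_inf_eq _⟩
  have hinf (N : Submodule R (E ⧸ L)) (hN : N ⊓ LinearMap.range (L.mkQ ∘ₗ f) = ⊥) :
      N.comap L.mkQ ⊓ LinearMap.range f = ⊥ := by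
    rw [eq_bot_iff, ← hL]
    rintro _ ⟨hx, x, rfl⟩
    have : L.mkQ (f x) ∈ N ⊓ LinearMap.range (L.mkQ ∘ₗ f) := ⟨hx, x, rfl⟩
    rw [hN, Submodule.mem_bot] at this
    exact ⟨(Submodule.Quotient.mk_eq_zero L).1 this, x, rfl⟩
  refine ⟨L, ?_, fun N hN => ?_⟩
  · rw [← LinearMap.ker_eq_bot, Submodule.eq_bot_iff]
    intro x hx
    have : f x ∈ L ⊓ LinearMap.range f := ⟨(Submodule.Quotient.mk_eq_zero L).1 hx, x, rfl⟩
    rw [hL, Submodule.mem_bot] at this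
    exact hf (this.trans f.map_zero.symm)
  · have hle : N.comap L.mkQ ≤ L := hmax (hinf N hN) (L.le_comap_mkQ N)
    rw [← Submodule.map_comap_eq_of_surjective L.mkQ_surjective N, eq_bot_iff]
    exact (Submodule.map_mono hle).trans (Submodule.mkQ_map_self L).le

theorem exists_essential_retract [IsArtinian R E] [IsNoetherian R E] [Module.Injective R E]
    {f : X →ₗ[R] E} (hf : Function.Injective f) :
    ∃ (L : Submodule R E) (s : E ⧸ L →ₗ[R] E), L.mkQ ∘ₗ s = LinearMap.id ∧
      Function.Injective (L.mkQ ∘ₗ f) ∧ IsEssential (LinearMap.range (L.mkQ ∘ₗ f)) := by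
  obtain ⟨L, hinj, hess⟩ := exists_mkQ_essential hf
  obtain ⟨g, hg⟩ := Module.Injective.extension_property R _ _ _ (L.mkQ ∘ₗ f) hinj f
  have hker : LinearMap.ker (L.mkQ ∘ₗ g) = ⊥ := by
    refine hess _ (eq_bot_iff.2 ?_)
    rintro _ ⟨hx, x, rfl⟩
    have hgx : g (L.mkQ (f x)) = f x := LinearMap.congr_fun hg x
    change L.mkQ (g (L.mkQ (f x))) = 0 at hx
    rw [hgx] at hx
    exact hx
  let u : (E ⧸ L) ≃ₗ[R] (E ⧸ L) := .ofBijective (L.mkQ ∘ₗ g)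
    (IsArtinian.bijective_of_injective_endomorphism _ (LinearMap.ker_eq_bot.1 hker))
  exact ⟨L, g ∘ₗ u.symm.toLinearMap, LinearMap.ext u.apply_symm_apply, hinj, hess⟩

theorem exists_projectiveCover_le [IsArtinian R E] [IsNoetherian R E] [Module.Projective R E]
    {π : E →ₗ[R] M} (hπ : Function.Surjective π) :
    ∃ F : Submodule R E, Module.Projective R F ∧ Function.Surjective (π.domRestrict F) ∧
      IsSuperfluous (LinearMap.ker (π.domRestrict F)) := by
  obtain ⟨F, hF, hmin⟩ := exists_minimal_of_wellFoundedLT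
    (fun F : Submodule R E => F.map π = ⊤) ⟨⊤, by rwa [Submodule.map_top, LinearMap.range_eq_top]⟩
  have hsurj : Function.Surjective (π.domRestrict F) := by
    rwa [← LinearMap.range_eq_top, LinearMap.range_domRestrict]
  have htop (N : Submodule R F) (hN : N.map (π.domRestrict F) = ⊤) : N = ⊤ := by
    have hle : F ≤ N.map F.subtype :=
      hmin ((Submodule.map_comp F.subtype π N).symm.trans hN) (F.map_subtype_le N)
    refine Submodule.map_injective_of_injective F.injective_subtype ?_
    rw [Submodule.map_subtype_top]
    exact (F.map_subtype_le N).antisymm hle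
  obtain ⟨g, hg⟩ := Module.projective_lifting_property (π.domRestrict F) π hsurj
  have hgF : Function.Surjective (g.domRestrict F) := by
    refine LinearMap.range_eq_top.1 (htop _ ?_)
    have : π.domRestrict F ∘ₗ g.domRestrict F = π.domRestrict F :=
      LinearMap.ext fun x => LinearMap.congr_fun hg x
    rw [← LinearMap.range_comp, this, LinearMap.range_eq_top.2 hsurj]
  let u : F ≃ₗ[R] F := .ofBijective (g.domRestrict F)
    (IsNoetherian.bijective_of_surjective_endomorphism _ hgF)
  refine ⟨F, .of_split F.subtype (u.symm.toLinearMap ∘ₗ g) (LinearMap.ext u.symm_apply_apply),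
    hsurj, fun N hN => htop N ?_⟩
  have := congrArg (Submodule.map (π.domRestrict F)) hN
  rwa [Submodule.map_sup, LinearMap.le_ker_iff_map.1 le_rfl, sup_bot_eq,
    Submodule.map_top, LinearMap.range_eq_top.2 hsurj] at this

variable (R M) in
theorem exists_projectiveCover [IsArtinianRing R] [Module.Finite R M] :
    ∃ (P : Type u) (_ : AddCommGroup P) (_ : Module R P) (π : P →ₗ[R] M),
      Module.Finite R P ∧ Module.Projective R P ∧ Function.Surjective π ∧
        IsSuperfluous (LinearMap.ker π) := by
  obtain ⟨n, f, hf⟩ := Module.Finite.exists_fin' R M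
  obtain ⟨F, hproj, hsurj, hker⟩ := exists_projectiveCover_le hf
  exact ⟨F, inferInstance, inferInstance, _, inferInstance, hproj, hsurj, hker⟩

variable (R M) in
theorem exists_minimalProjectivePresentation [IsArtinianRing R] [Module.Finite R M] :
    Nonempty (MinimalProjectivePresentation R M) := by
  obtain ⟨P₀, _, _, π, _, h₀, hπ, hker₀⟩ := exists_projectiveCover R M
  obtain ⟨P₁, _, _, d, _, h₁, hd, hker₁⟩ := exists_projectiveCover R (LinearMap.ker π)
  exact ⟨{
    P₀ := P₀
    P₁ := P₁
    projective₀ := h₀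
    projective₁ := h₁
    π := π
    d := (LinearMap.ker π).subtype ∘ₗ d
    π_surjective := hπ
    exact := by
      rw [LinearMap.exact_iff, LinearMap.range_comp, LinearMap.range_eq_top.2 hd,
        Submodule.map_subtype_top]
    superfluous₀ := hker₀
    superfluous₁ := by
      rwa [LinearMap.ker_comp_of_ker_eq_bot _ (Submodule.ker_subtype _)] }⟩

theorem finite_of_isSuperfluous_ker [Module.Finite R M] {π : E →ₗ[R] M}
    (hπ : Function.Surjective π) (hker : IsSuperfluous (LinearMap.ker π)) : Module.Finite R E := by
  obtain ⟨n, f, hf⟩ := Module.Finite.exists_fin' R M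
  obtain ⟨g, hg⟩ := Module.projective_lifting_property π f hπ
  have hsup : LinearMap.range g ⊔ LinearMap.ker π = ⊤ := by
    rw [← Submodule.comap_map_eq, ← LinearMap.range_comp, hg, LinearMap.range_eq_top.2 hf,
      Submodule.comap_top]
  exact Module.Finite.of_surjective g (LinearMap.range_eq_top.1 (hker _ hsup))

end Minimality

section Duality

/-- The identification of `S` with the opposite of `R` obtained from one of `R` with the opposite
of `S`. It exchanges the roles of the two rings, that is, of right and left modules. -/
abbrev opSymm {K R S : Type u} [CommSemiring K] [Semiring R] [Semiring S] [Algebra K R]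
    [Algebra K S] (θ : R ≃ₐ[K] Sᵐᵒᵖ) : S ≃ₐ[K] Rᵐᵒᵖ :=
  (AlgEquiv.opComm θ).symm

/-- The `K`-dual of an `R`-module, an `S`-module when `θ` identifies `R` with the opposite of `S`.
This treats the duality in both directions at once: `KDual K A M` is `DualModule θ M` for the
identity `θ` of `Aᵐᵒᵖ`, and the dual of a left `A`-module is taken along `opSymm θ`. -/
def DualModule {K R S : Type u} [Field K] [Ring R] [Ring S] [Algebra K R] [Algebra K S]
    (_θ : R ≃ₐ[K] Sᵐᵒᵖ) (X : Type u) [AddCommGroup X] [Module K X] : Type u :=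
  X →ₗ[K] K

namespace DualModule

variable {K R S : Type u} [Field K] [Ring R] [Ring S] [Algebra K R] [Algebra K S]
  {θ : R ≃ₐ[K] Sᵐᵒᵖ} {X Y Z N : Type u} [AddCommGroup X] [Module K X] [AddCommGroup Y] [Module K Y]
  [AddCommGroup Z] [Module K Z] [AddCommGroup N] [Module K N]

instance : AddCommGroup (DualModule θ X) :=
  inferInstanceAs (AddCommGroup (X →ₗ[K] K))

instance : Module K (DualModule θ X) :=
  inferInstanceAs (Module K (X →ₗ[K] K))

instance : FunLike (DualModule θ X) X K :=
  inferInstanceAs (FunLike (X →ₗ[K] K) X K)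

instance : LinearMapClass (DualModule θ X) K X K :=
  inferInstanceAs (LinearMapClass (X →ₗ[K] K) K X K)

instance [FiniteDimensional K X] : FiniteDimensional K (DualModule θ X) :=
  inferInstanceAs (FiniteDimensional K (X →ₗ[K] K))

@[ext] theorem ext {μ ν : DualModule θ X} (h : ∀ x, μ x = ν x) : μ = ν :=
  LinearMap.ext h

theorem eq_zero_of_forall_apply_eq_zero (θ : R ≃ₐ[K] Sᵐᵒᵖ) {x : X}
    (h : ∀ μ : DualModule θ X, μ x = 0) : x = 0 :=
  (Module.forall_dual_apply_eq_zero_iff K x).1 h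

theorem eq_of_forall_apply_eq (θ : R ≃ₐ[K] Sᵐᵒᵖ) {x y : X}
    (h : ∀ μ : DualModule θ X, μ x = μ y) : x = y :=
  sub_eq_zero.1 (eq_zero_of_forall_apply_eq_zero θ fun μ => by rw [map_sub, h, sub_self])

variable [Module R X] [IsScalarTower K R X] [Module R Y] [IsScalarTower K R Y] [Module R Z]
  [IsScalarTower K R Z] [Module S N] [IsScalarTower K S N]

instance : Module S (DualModule θ X) where
  smul s μ := LinearMap.comp (show X →ₗ[K] K from μ) (Algebra.lsmul K K X (θ.symm (op s)))
  one_smul μ := ext fun x => congrArg μ (by simp)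
  mul_smul a b μ := ext fun x => congrArg μ (by
    change θ.symm (op (a * b)) • x = θ.symm (op b) • θ.symm (op a) • x
    rw [MulOpposite.op_mul, map_mul, mul_smul])
  smul_zero _ := rfl
  smul_add _ _ _ := rfl
  add_smul a b μ := ext fun x => by
    change μ (θ.symm (op (a + b)) • x) = μ (θ.symm (op a) • x) + μ (θ.symm (op b) • x)
    rw [MulOpposite.op_add, map_add, add_smul, map_add]
  zero_smul μ := ext fun x => by
    change μ (θ.symm (op 0) • x) = 0
    rw [MulOpposite.op_zero, map_zero, zero_smul, map_zero]

@[simp] theorem smul_apply (s : S) (μ : DualModule θ X) (x : X) :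
    (s • μ) x = μ (θ.symm (op s) • x) :=
  rfl

instance : IsScalarTower K S (DualModule θ X) where
  smul_assoc k s μ := ext fun x => by
    rw [smul_apply, op_smul, map_smul θ.symm, smul_assoc]
    exact map_smul μ k _

instance [FaithfulSMul R X] : FaithfulSMul S (DualModule θ X) where
  eq_of_smul_eq_smul {a b} h := by
    refine op_injective (θ.symm.injective (FaithfulSMul.eq_of_smul_eq_smul fun x : X => ?_))
    exact eq_of_forall_apply_eq θ fun μ => DFunLike.congr_fun (h μ) x

/-- The dual of a linear map. -/
def map (θ : R ≃ₐ[K] Sᵐᵒᵖ) (f : X →ₗ[R] Y) : DualModule θ Y →ₗ[S] DualModule θ X where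
  toFun μ := (f.restrictScalars K).dualMap μ
  map_add' _ _ := rfl
  map_smul' s μ := ext fun x => congrArg μ (map_smul f (θ.symm (op s)) x).symm

@[simp] theorem map_apply (f : X →ₗ[R] Y) (μ : DualModule θ Y) (x : X) : map θ f μ x = μ (f x) :=
  rfl

theorem map_injective {f : X →ₗ[R] Y} (hf : Function.Surjective f) :
    Function.Injective (map θ f) :=
  LinearMap.dualMap_injective_of_surjective (f := f.restrictScalars K) hf

theorem map_surjective {f : X →ₗ[R] Y} (hf : Function.Injective f) :
    Function.Surjective (map θ f) :=
  LinearMap.dualMap_surjective_of_injective (f := f.restrictScalars K) hf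

theorem map_exact {f : X →ₗ[R] Y} {g : Y →ₗ[R] Z} (h : Function.Exact f g) :
    Function.Exact (map θ g) (map θ f) := by
  have hK : LinearMap.range (f.restrictScalars K) = LinearMap.ker (g.restrictScalars K) :=
    (LinearMap.exact_iff (f := f.restrictScalars K) (g := g.restrictScalars K)).1 h |>.symm
  have : Function.Exact (g.restrictScalars K).dualMap (f.restrictScalars K).dualMap := by
    rw [LinearMap.exact_iff, LinearMap.ker_dualMap_eq_dualAnnihilator_range, hK,
      LinearMap.range_dualMap_eq_dualAnnihilator_ker]
  exact this

/-- A finite dimensional module is isomorphic to its double dual. -/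
noncomputable def evalEquiv (θ : R ≃ₐ[K] Sᵐᵒᵖ) (X : Type u) [AddCommGroup X] [Module K X]
    [Module R X] [IsScalarTower K R X] [FiniteDimensional K X] :
    X ≃ₗ[R] DualModule (opSymm θ) (DualModule θ X) where
  __ := (Module.evalEquiv K X).toAddEquiv
  map_smul' r x := by
    ext μ
    change μ (r • x) = μ (θ.symm (θ r) • x)
    rw [AlgEquiv.symm_apply_apply]

/-- The linear map `D(N) → X` adjoint to `h : D(X) → N`, see `apply_transpose`. -/
noncomputable def transpose [FiniteDimensional K X] (h : DualModule θ X →ₗ[S] N) :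
    DualModule (opSymm θ) N →ₗ[R] X :=
  (evalEquiv θ X).symm.toLinearMap ∘ₗ map (opSymm θ) h

@[simp] theorem apply_transpose [FiniteDimensional K X] (h : DualModule θ X →ₗ[S] N)
    (μ : DualModule θ X) (ν : DualModule (opSymm θ) N) : μ (transpose h ν) = ν (h μ) :=
  Module.apply_evalEquiv_symm_apply (R := K) (M := X) μ (map (opSymm θ) h ν)

/-- The linear map `X → D(N)` with `flip g x n = g n x`. -/
def flip (g : N →ₗ[S] DualModule θ X) : X →ₗ[R] DualModule (opSymm θ) N where
  toFun x := LinearMap.flip (g.restrictScalars K : N →ₗ[K] X →ₗ[K] K) x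
  map_add' _ _ := map_add (LinearMap.flip (g.restrictScalars K : N →ₗ[K] X →ₗ[K] K)) _ _
  map_smul' r x := ext fun n => by
    change g n (r • x) = g (unop (θ r) • n) x
    rw [map_smul g, smul_apply, op_unop, AlgEquiv.symm_apply_apply]

theorem flip_injective {g : N →ₗ[S] DualModule θ X} (hg : Function.Surjective g) :
    Function.Injective (flip g) := by
  refine (injective_iff_map_eq_zero _).2 fun x hx => eq_zero_of_forall_apply_eq_zero θ fun μ => ?_
  obtain ⟨n, rfl⟩ := hg μ
  exact DFunLike.congr_fun hx n

theorem projective_of_injective [FiniteDimensional K S] [FiniteDimensional K X]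
    [Module.Injective R X] : Module.Projective S (DualModule θ X) := by
  have : Module.Finite S (DualModule θ X) := .of_restrictScalars_finite K S _
  obtain ⟨n, q, hq⟩ := Module.Finite.exists_fin' S (DualModule θ X)
  obtain ⟨p, hp⟩ := Module.Injective.extension_property R _ _ _ (flip q) (flip_injective hq)
    LinearMap.id
  let s : DualModule θ X →ₗ[S] Fin n → S := transpose (θ := opSymm θ) p
  refine .of_split s q (LinearMap.ext fun μ => ext fun x => ?_)
  calc q (s μ) x = flip q x (s μ) := rfl
    _ = μ (p (flip q x)) := apply_transpose (θ := opSymm θ) p (flip q x) μ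
    _ = μ x := congrArg μ (LinearMap.congr_fun hp x)

theorem injective_of_projective [Module.Projective R X] : Module.Injective S (DualModule θ X) := by
  refine Module.Baer.injective fun I g => ?_
  obtain ⟨h, hh⟩ := Module.projective_lifting_property (map (opSymm θ) I.subtype) (flip g)
    (map_surjective I.injective_subtype)
  exact ⟨flip (θ := opSymm θ) h, fun a ha => ext fun x =>
    DFunLike.congr_fun (LinearMap.congr_fun hh x) ⟨a, ha⟩⟩

end DualModule

end Duality

section Reflexivity

theorem exists_comp_eq_of_ker_le {R M N P : Type u} [Ring R] [AddCommGroup M] [Module R M]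
    [AddCommGroup N] [Module R N] [AddCommGroup P] [Module R P] {q : M →ₗ[R] N}
    (hq : Function.Surjective q) {f : M →ₗ[R] P} (h : LinearMap.ker q ≤ LinearMap.ker f) :
    ∃ g : N →ₗ[R] P, g ∘ₗ q = f :=
  ⟨(LinearMap.ker q).liftQ f h ∘ₗ (q.quotKerEquivOfSurjective hq).symm.toLinearMap,
    LinearMap.ext fun x => by
      rw [LinearMap.comp_apply, LinearMap.comp_apply, LinearEquiv.coe_coe,
        (LinearEquiv.symm_apply_eq _).2 (q.quotKerEquivOfSurjective_apply_mk hq x).symm,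
        Submodule.liftQ_apply]⟩

/-- `T` is the regular bimodule: free of rank one on the same element `one` over both rings. It
stands for `A` as a module over `Aᵐᵒᵖ` and `A`, in either order, with `one = 1`. -/
structure IsRegularBimodule (R S : Type u) {T : Type u} [Ring R] [Ring S] [AddCommGroup T]
    [Module R T] [Module S T] (one : T) : Prop where
  bijective_left : Function.Bijective fun r : R => r • one
  bijective_right : Function.Bijective fun s : S => s • one

variable {R S T : Type u} [Ring R] [Ring S] [AddCommGroup T] [Module R T] [Module S T]
  {one : T} {X P P₁ M N : Type u}
  [AddCommGroup X] [Module R X] [AddCommGroup P] [Module R P] [AddCommGroup P₁] [Module R P₁]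
  [AddCommGroup M] [Module R M] [AddCommGroup N] [Module R N]

namespace IsRegularBimodule

theorem symm (h : IsRegularBimodule R S one) : IsRegularBimodule S R one :=
  ⟨h.bijective_right, h.bijective_left⟩

/-- The isomorphism `r ↦ r • one` from the ring to its regular bimodule. -/
noncomputable def equiv (h : IsRegularBimodule R S one) : R ≃ₗ[R] T :=
  .ofBijective (LinearMap.toSpanSingleton R T one) h.bijective_left

/-- The linear map `T → X` that sends `one` to `x`. -/
noncomputable def lift (h : IsRegularBimodule R S one) (x : X) : T →ₗ[R] X :=
  LinearMap.toSpanSingleton R X x ∘ₗ h.equiv.symm.toLinearMap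

theorem lift_smul_one (h : IsRegularBimodule R S one) (x : X) (r : R) :
    h.lift x (r • one) = r • x :=
  congrArg (· • x) (h.equiv.symm_apply_apply r)

@[simp] theorem lift_one (h : IsRegularBimodule R S one) (x : X) : h.lift x one = x := by
  simpa only [one_smul] using h.lift_smul_one x 1

theorem hom_ext (h : IsRegularBimodule R S one) {f g : T →ₗ[R] X} (hfg : f one = g one) :
    f = g := by
  ext t
  obtain ⟨r, rfl⟩ := h.bijective_left.2 t
  simp only [map_smul, hfg]

theorem comp_lift (h : IsRegularBimodule R S one) (f : X →ₗ[R] M) (x : X) :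
    f ∘ₗ h.lift x = h.lift (f x) :=
  h.hom_ext (by simp)

theorem exists_dualBasis (h : IsRegularBimodule R S one) (P : Type u) [AddCommGroup P] [Module R P]
    [Module.Finite R P] [Module.Projective R P] :
    ∃ (n : ℕ) (p : Fin n → (T →ₗ[R] P)) (v : Fin n → (P →ₗ[R] T)),
      ∀ x, ∑ i, p i (v i x) = x := by
  obtain ⟨n, q, hq⟩ := Module.Finite.exists_fin' R P
  obtain ⟨s, hs⟩ := Module.projective_lifting_property q LinearMap.id hq
  refine ⟨n, fun i => h.lift (q (Pi.single i 1)),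
    fun i => LinearMap.toSpanSingleton R T one ∘ₗ LinearMap.proj i ∘ₗ s, fun x => ?_⟩
  calc ∑ i, h.lift (q (Pi.single i 1)) (s x i • one) = q (∑ i, s x i • Pi.single i 1) := by
        rw [map_sum]
        exact Finset.sum_congr rfl fun i _ => (h.lift_smul_one _ _).trans (map_smul q _ _).symm
    _ = q (s x) := congrArg q (pi_eq_sum_univ' (s x)).symm
    _ = x := LinearMap.congr_fun hs x

variable [SMulCommClass S R T]

theorem apply_eq_smul (h : IsRegularBimodule R S one) (f : T →ₗ[R] T) (t : T) :
    f t = h.symm.equiv.symm (f one) • t := by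
  have : f = DistribSMul.toLinearMap R T (h.symm.equiv.symm (f one)) :=
    h.hom_ext (h.symm.equiv.apply_symm_apply (f one)).symm
  exact LinearMap.congr_fun this t

variable [SMulCommClass R S T]

theorem sum_smul_eq (h : IsRegularBimodule R S one) {n : ℕ} {p : Fin n → (T →ₗ[R] P)}
    {v : Fin n → (P →ₗ[R] T)} (hpv : ∀ x, ∑ i, p i (v i x) = x) (f : P →ₗ[R] T) :
    ∑ i, h.symm.equiv.symm (f (p i one)) • v i = f := by
  ext x
  calc (∑ i, h.symm.equiv.symm (f (p i one)) • v i) x = ∑ i, f (p i (v i x)) := by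
        rw [LinearMap.sum_apply]
        exact Finset.sum_congr rfl fun i _ => (h.apply_eq_smul (f ∘ₗ p i) (v i x)).symm
    _ = f x := by rw [← map_sum, hpv]

variable (P) in
theorem exists_hom_retract (h : IsRegularBimodule R S one) [Module.Finite R P]
    [Module.Projective R P] :
    ∃ (n : ℕ) (i : (P →ₗ[R] T) →ₗ[S] Fin n → S) (q : (Fin n → S) →ₗ[S] P →ₗ[R] T),
      q ∘ₗ i = LinearMap.id := by
  obtain ⟨n, p, v, hpv⟩ := h.exists_dualBasis P
  exact ⟨n, LinearMap.pi fun j => h.symm.equiv.symm.toLinearMap ∘ₗ LinearMap.applyₗ' S (p j one),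
    Fintype.linearCombination S v, LinearMap.ext (h.sum_smul_eq hpv)⟩

theorem projective_hom (h : IsRegularBimodule R S one) [Module.Finite R P]
    [Module.Projective R P] : Module.Projective S (P →ₗ[R] T) := by
  obtain ⟨n, i, q, hqi⟩ := h.exists_hom_retract P
  exact .of_split i q hqi

theorem finite_hom (h : IsRegularBimodule R S one) [Module.Finite R P]
    [Module.Projective R P] : Module.Finite S (P →ₗ[R] T) := by
  obtain ⟨n, i, q, hqi⟩ := h.exists_hom_retract P
  exact .of_surjective q (LinearMap.surjective_of_comp_eq_id i q hqi)

end IsRegularBimodule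

variable (S T) in
theorem exact_lcomp [SMulCommClass R S T] {d : P₁ →ₗ[R] P} {π : P →ₗ[R] M}
    (hdπ : Function.Exact d π) (hπ : Function.Surjective π) :
    Function.Exact (LinearMap.lcomp S T π) (LinearMap.lcomp S T d) := by
  refine fun φ => ⟨fun hφ => exists_comp_eq_of_ker_le hπ ?_, ?_⟩
  · rw [hdπ.linearMap_ker_eq]
    exact LinearMap.range_le_ker_iff.2 hφ
  · rintro ⟨ψ, rfl⟩
    exact LinearMap.ext fun y => by simp [hdπ.apply_apply_eq_zero]

section Bidual

variable [SMulCommClass R S T] [SMulCommClass S R T]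

variable (R S T X) in
/-- The evaluation map `X → X**` into the double `T`-dual. -/
def bidualEval : X →ₗ[R] (X →ₗ[R] T) →ₗ[S] T where
  toFun x := LinearMap.applyₗ' S x
  map_add' := map_add (LinearMap.applyₗ' S)
  map_smul' r x := LinearMap.ext fun f => map_smul f r x

@[simp] theorem bidualEval_apply (x : X) (f : X →ₗ[R] T) : bidualEval R S T X x f = f x :=
  rfl

variable (R S T X) in
theorem bidualEval_hom_injective : Function.Injective (bidualEval S R T (X →ₗ[R] T)) :=
  fun _ _ h => LinearMap.ext fun x => LinearMap.congr_fun h (bidualEval R S T X x)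

theorem IsRegularBimodule.bidualEval_bijective (h : IsRegularBimodule R S one) [Module.Finite R P]
    [Module.Projective R P] : Function.Bijective (bidualEval R S T P) := by
  obtain ⟨n, p, v, hpv⟩ := h.exists_dualBasis P
  refine ⟨(injective_iff_map_eq_zero _).2 fun x hx => ?_, fun F => ⟨∑ i, p i (F (v i)), ?_⟩⟩
  · rw [← hpv x]
    refine Finset.sum_eq_zero fun i _ => ?_
    rw [← bidualEval_apply (S := S) x (v i), hx, LinearMap.zero_apply, map_zero]
  · ext f
    calc f (∑ i, p i (F (v i))) = ∑ i, h.symm.equiv.symm (f (p i one)) • F (v i) := by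
          rw [map_sum]
          exact Finset.sum_congr rfl fun i _ => h.apply_eq_smul (f ∘ₗ p i) (F (v i))
      _ = F (∑ i, h.symm.equiv.symm (f (p i one)) • v i) := by simp only [map_sum, map_smul]
      _ = F f := congrArg F (h.sum_smul_eq hpv f)

theorem bidualEval_surjective_iff {π : P →ₗ[R] M} (hπ : Function.Surjective π)
    (hP : Function.Surjective (bidualEval R S T P)) :
    Function.Surjective (bidualEval R S T M) ↔
      ∀ f : (M →ₗ[R] T) →ₗ[S] T, ∃ g : (P →ₗ[R] T) →ₗ[S] T, g ∘ₗ LinearMap.lcomp S T π = f := by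
  refine forall_congr' fun f => ⟨?_, ?_⟩
  · rintro ⟨m, rfl⟩
    obtain ⟨x, rfl⟩ := hπ m
    exact ⟨bidualEval R S T P x, rfl⟩
  · rintro ⟨g, rfl⟩
    obtain ⟨x, rfl⟩ := hP g
    exact ⟨π x, rfl⟩

theorem bidualEval_injective_iff {d : P₁ →ₗ[R] P} {π : P →ₗ[R] M} (hπ : Function.Surjective π)
    (hdπ : Function.Exact d π) (hP : Function.Bijective (bidualEval R S T P))
    (hP₁ : Function.Surjective (bidualEval R S T P₁)) :
    Function.Injective (bidualEval R S T M) ↔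
      ∀ f : LinearMap.range (LinearMap.lcomp S T d) →ₗ[S] T, ∃ g : (P₁ →ₗ[R] T) →ₗ[S] T,
        g ∘ₗ (LinearMap.range (LinearMap.lcomp S T d)).subtype = f := by
  let D := LinearMap.lcomp S T d
  have hexact : Function.Exact (LinearMap.lcomp S T π) D := exact_lcomp S T hdπ hπ
  constructor
  · intro hM f
    obtain ⟨x, hx⟩ := hP.2 (f ∘ₗ D.rangeRestrict)
    have hπx : π x = 0 := hM <| LinearMap.ext fun ψ => by
      calc ψ (π x) = f (D.rangeRestrict (ψ ∘ₗ π)) := LinearMap.congr_fun hx (ψ ∘ₗ π)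
        _ = f 0 := congrArg f (Subtype.ext (hexact.apply_apply_eq_zero ψ))
        _ = bidualEval R S T M 0 ψ := by simp
    obtain ⟨y, rfl⟩ := (hdπ x).1 hπx
    refine ⟨bidualEval R S T P₁ y, LinearMap.ext ?_⟩
    rintro ⟨_, φ, rfl⟩
    exact LinearMap.congr_fun hx φ
  · refine fun hext => (injective_iff_map_eq_zero _).2 fun m hm => ?_
    obtain ⟨x, rfl⟩ := hπ m
    obtain ⟨f, hf⟩ := exists_comp_eq_of_ker_le (f := bidualEval R S T P x)
      D.surjective_rangeRestrict (by
        intro φ hφ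
        obtain ⟨ψ, rfl⟩ := (hexact φ).1 (congrArg Subtype.val hφ)
        exact LinearMap.congr_fun hm ψ)
    obtain ⟨g, rfl⟩ := hext f
    obtain ⟨y, rfl⟩ := hP₁ g
    have hxy : x = d y := hP.1 (hf.symm.trans rfl)
    rw [hxy, hdπ.apply_apply_eq_zero]

theorem IsRegularBimodule.extVanishes_transpose_iff (h : IsRegularBimodule R S one)
    [Module.Finite R M] [IsNoetherianRing R] (X : MinimalProjectivePresentation R M) :
    ExtVanishes S (X.Transpose S T) T ↔
      Function.Bijective (bidualEval R S T M) ∧ ExtVanishes S (M →ₗ[R] T) T := by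
  have := X.projective₀
  have := X.projective₁
  have := finite_of_isSuperfluous_ker X.π_surjective X.superfluous₀
  have hd : Function.Surjective X.d.rangeRestrict := X.d.surjective_rangeRestrict
  have := finite_of_isSuperfluous_ker hd (by rw [LinearMap.ker_rangeRestrict]; exact X.superfluous₁)
  have := h.projective_hom (P := X.P₀)
  have := h.projective_hom (P := X.P₁)
  have hP₀ := h.bidualEval_bijective (P := X.P₀)
  have hP₁ := h.bidualEval_bijective (P := X.P₁)
  have hexact : Function.Exact (LinearMap.lcomp S T X.π) (X.dualMap S T).rangeRestrict := by
    rw [LinearMap.exact_iff, LinearMap.ker_rangeRestrict]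
    exact (exact_lcomp S T X.exact X.π_surjective).linearMap_ker_eq
  rw [extVanishes_iff_of_exact (Submodule.injective_subtype _) (Submodule.mkQ_surjective _)
      (LinearMap.exact_subtype_mkQ (LinearMap.range (X.dualMap S T))),
    extVanishes_iff_of_exact (LinearMap.lcomp_injective_of_surjective X.π X.π_surjective)
      (LinearMap.surjective_rangeRestrict _) hexact,
    ← and_assoc, Function.Bijective, bidualEval_surjective_iff X.π_surjective hP₀.2,
    bidualEval_injective_iff X.π_surjective X.exact hP₀ hP₁.2]
  rfl

end Bidual

end Reflexivity

section Comparison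

variable {K R S : Type u} [Field K] [Ring R] [Ring S] [Algebra K R] [Algebra K S]

/-- A bimodule homomorphism `ω : D(T) → T` from the dual of the regular bimodule such that every
`S`-linear map `D(T) → T` is a unique multiple of `ω`. A gendo-symmetric algebra carries such an
`ω`, which is all that the comparison of `Y` with `Hom_S(D(Y), T)` needs. -/
@[ext]
structure CanonicalHom (θ : R ≃ₐ[K] Sᵐᵒᵖ) {T : Type u} [AddCommGroup T] [Module K T] [Module R T]
    [Module S T] [IsScalarTower K R T] [SMulCommClass R S T] [SMulCommClass S R T] (one : T) where
  regular : IsRegularBimodule R S one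
  hom : DualModule θ T →ₗ[S] T
  hom_map : ∀ (r : R) (s : S), r • one = s • one → ∀ μ,
    hom (DualModule.map θ (DistribSMul.toLinearMap R T s) μ) = r • hom μ
  bijective : Function.Bijective fun r : R => r • hom

namespace CanonicalHom

variable {θ : R ≃ₐ[K] Sᵐᵒᵖ} {T : Type u} [AddCommGroup T] [Module K T] [Module R T] [Module S T]
  [IsScalarTower K R T] [SMulCommClass R S T] [SMulCommClass S R T]
  {one : T} {X Y Z N : Type u} [AddCommGroup X] [Module K X] [Module R X] [IsScalarTower K R X]
  [AddCommGroup Y] [Module K Y] [Module R Y] [IsScalarTower K R Y]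
  [AddCommGroup Z] [Module K Z] [Module R Z] [IsScalarTower K R Z]
  [AddCommGroup N] [Module S N]

variable (Y) in
/-- The natural map `Y → Hom_S(D(Y), T)` given by composing `ω` with the dual of the map `T → Y`
determined by an element of `Y`. -/
noncomputable def comparison (c : CanonicalHom θ one) : Y →ₗ[R] DualModule θ Y →ₗ[S] T where
  toFun y := c.hom ∘ₗ DualModule.map θ (c.regular.lift y)
  map_add' y z := LinearMap.ext fun μ => by
    have : c.regular.lift (y + z) = c.regular.lift y + c.regular.lift z :=
      c.regular.hom_ext (by simp)
    rw [this]
    exact (congrArg c.hom (DualModule.ext fun t => map_add μ _ _)).trans (map_add c.hom _ _)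
  map_smul' r y := LinearMap.ext fun μ => by
    obtain ⟨s, hs⟩ := c.regular.bijective_right.2 (r • one)
    have : c.regular.lift (r • y) = c.regular.lift y ∘ₗ DistribSMul.toLinearMap R T s :=
      c.regular.hom_ext (by
        change _ = c.regular.lift y (s • one)
        rw [show s • one = r • one from hs, c.regular.lift_one, c.regular.lift_smul_one])
    rw [this]
    exact c.hom_map r s hs.symm (DualModule.map θ (c.regular.lift y) μ)

theorem comparison_apply (c : CanonicalHom θ one) (y : Y) :
    c.comparison Y y = c.hom ∘ₗ DualModule.map θ (c.regular.lift y) :=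
  rfl

theorem comparison_map (c : CanonicalHom θ one) (f : Y →ₗ[R] Z) (y : Y) :
    c.comparison Z (f y) = c.comparison Y y ∘ₗ DualModule.map θ f := by
  rw [comparison_apply, ← c.regular.comp_lift]
  rfl

theorem comparison_self_bijective (c : CanonicalHom θ one) :
    Function.Bijective (c.comparison T) := by
  have hone : c.comparison T one = c.hom := by
    have : c.regular.lift one = LinearMap.id := c.regular.hom_ext (c.regular.lift_one one)
    rw [comparison_apply, this]
    rfl
  refine (Function.Bijective.of_comp_iff _ c.regular.bijective_left).1 ?_
  convert c.bijective using 2 with r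
  rw [Function.comp_apply, map_smul, hone]

theorem comparison_bijective_of_projective (c : CanonicalHom θ one) [Module.Finite R Y]
    [Module.Projective R Y] : Function.Bijective (c.comparison Y) := by
  obtain ⟨n, p, v, hpv⟩ := c.regular.exists_dualBasis Y
  refine ⟨(injective_iff_map_eq_zero _).2 fun y hy => ?_, fun h => ?_⟩
  · rw [← hpv y]
    refine Finset.sum_eq_zero fun i _ => ?_
    have : c.comparison T (v i y) = c.comparison T 0 := by
      rw [comparison_map, hy, LinearMap.zero_comp, map_zero]
    rw [c.comparison_self_bijective.1 this, map_zero]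
  · choose t ht using fun i => c.comparison_self_bijective.2 (h ∘ₗ DualModule.map θ (v i))
    refine ⟨∑ i, p i (t i), LinearMap.ext fun μ => ?_⟩
    calc c.comparison Y (∑ i, p i (t i)) μ
        = ∑ i, h (DualModule.map θ (v i) (DualModule.map θ (p i) μ)) := by
          simp only [map_sum, comparison_map, ht, LinearMap.sum_apply]
          rfl
      _ = h (∑ i, DualModule.map θ (v i) (DualModule.map θ (p i) μ)) := (map_sum h _ _).symm
      _ = h μ := congrArg h (DualModule.ext fun x => by
          refine (LinearMap.sum_apply _ _ _).trans ?_
          exact (map_sum μ _ _).symm.trans (congrArg μ (hpv x)))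

theorem comparison_eq_zero_iff (c : CanonicalHom θ one) (y : Y) :
    c.comparison Y y = 0 ↔ bidualEval R S T Y y = 0 := by
  constructor <;> refine fun h => LinearMap.ext fun f => ?_
  · have : c.comparison T (f y) = c.comparison T 0 := by
      rw [comparison_map, h, LinearMap.zero_comp, map_zero]
    exact c.comparison_self_bijective.1 this
  · exact LinearMap.congr_fun h (LinearMap.applyₗ' R f ∘ₗ c.comparison Y)

theorem comparison_injective_iff (c : CanonicalHom θ one) :
    Function.Injective (c.comparison Y) ↔ Function.Injective (bidualEval R S T Y) := by
  simp only [injective_iff_map_eq_zero, comparison_eq_zero_iff]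

theorem comparison_injective_of_injective (c : CanonicalHom θ one) {f : Y →ₗ[R] X}
    (hf : Function.Injective f) (hX : Function.Injective (c.comparison X)) :
    Function.Injective (c.comparison Y) := by
  refine (injective_iff_map_eq_zero _).2 fun y hy => hf (hX ?_)
  rw [map_zero, comparison_map, hy, LinearMap.zero_comp, map_zero]

theorem comparison_bijective_of_exact (c : CanonicalHom θ one) {f : Y →ₗ[R] X} {g : X →ₗ[R] Z}
    (hf : Function.Injective f) (hfg : Function.Exact f g)
    (hX : Function.Bijective (c.comparison X)) (hZ : Function.Injective (c.comparison Z)) :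
    Function.Bijective (c.comparison Y) := by
  refine ⟨c.comparison_injective_of_injective hf hX.1, fun h => ?_⟩
  obtain ⟨x, hx⟩ := hX.2 (h ∘ₗ DualModule.map θ f)
  have hgx : g x = 0 := hZ (by
    rw [comparison_map, hx, LinearMap.comp_assoc, (DualModule.map_exact hfg).linearMap_comp_eq_zero,
      LinearMap.comp_zero, map_zero])
  obtain ⟨y, rfl⟩ := (hfg x).1 hgx
  rw [comparison_map] at hx
  exact ⟨y, (LinearMap.cancel_right (DualModule.map_surjective hf)).1 hx⟩

theorem comparison_bijective_of_linearEquiv (c : CanonicalHom θ one) (e : Y ≃ₗ[R] Z)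
    (hZ : Function.Bijective (c.comparison Z)) : Function.Bijective (c.comparison Y) :=
  c.comparison_bijective_of_exact (g := (0 : Z →ₗ[R] PUnit.{u + 1})) e.injective
    ((LinearMap.exact_zero_iff_surjective PUnit.{u + 1} e.toLinearMap).2 e.surjective) hZ
    (Function.injective_of_subsingleton _)

theorem comparison_injective_of_exact (c : CanonicalHom θ one) {f : Y →ₗ[R] X} {g : X →ₗ[R] Z}
    (hf : Function.Injective f) (hfg : Function.Exact f g) (hg : Function.Surjective g)
    (hY : Function.Surjective (c.comparison Y)) (hX : Function.Injective (c.comparison X)) :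
    Function.Injective (c.comparison Z) := by
  refine (injective_iff_map_eq_zero _).2 fun z hz => ?_
  obtain ⟨x, rfl⟩ := hg z
  rw [comparison_map] at hz
  obtain ⟨h, hh⟩ := exists_comp_eq_of_ker_le (f := c.comparison X x) (DualModule.map_surjective hf)
    (by
      rw [(DualModule.map_exact hfg).linearMap_ker_eq]
      exact LinearMap.range_le_ker_iff.2 hz)
  obtain ⟨y, rfl⟩ := hY h
  rw [← comparison_map] at hh
  rw [← hX hh, hfg.apply_apply_eq_zero]

theorem comparison_surjective_iff (c : CanonicalHom θ one) {g : X →ₗ[R] Z}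
    (hg : Function.Surjective g) (hX : Function.Surjective (c.comparison X)) :
    Function.Surjective (c.comparison Z) ↔
      ∀ h : DualModule θ Z →ₗ[S] T, ∃ k : DualModule θ X →ₗ[S] T, k ∘ₗ DualModule.map θ g = h := by
  refine forall_congr' fun h => ⟨?_, ?_⟩
  · rintro ⟨z, rfl⟩
    obtain ⟨x, rfl⟩ := hg z
    exact ⟨c.comparison X x, (c.comparison_map g x).symm⟩
  · rintro ⟨k, rfl⟩
    obtain ⟨x, rfl⟩ := hX k
    exact ⟨g x, c.comparison_map g x⟩

theorem comparison_hom_bijective [IsScalarTower K S T] (c : CanonicalHom θ one)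
    [Module.Finite S N] : Function.Bijective (c.comparison (N →ₗ[S] T)) := by
  obtain ⟨n, q, hq⟩ := Module.Finite.exists_fin' S N
  have := c.regular.symm.projective_hom (P := Fin n → S)
  have := c.regular.symm.finite_hom (P := Fin n → S)
  exact c.comparison_bijective_of_exact (LinearMap.lcomp_injective_of_surjective q hq)
    (exact_lcomp R T q.exact_subtype_ker_map hq) c.comparison_bijective_of_projective
    (c.comparison_injective_iff.2 (bidualEval_hom_injective S R T _))

/-- The adjoint of `ω`, with the two rings exchanged. -/
noncomputable def symm [IsScalarTower K S T] [FiniteDimensional K T] (c : CanonicalHom θ one) :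
    CanonicalHom (opSymm θ) one where
  regular := c.regular.symm
  hom := DualModule.transpose c.hom
  hom_map s r hsr ν := DualModule.eq_of_forall_apply_eq θ fun μ => by
    rw [DualModule.apply_transpose, DualModule.map_apply]
    change ν (r • c.hom μ) = DualModule.map θ (DistribSMul.toLinearMap R T s) μ _
    rw [← c.hom_map r s hsr.symm, DualModule.apply_transpose]
  bijective := by
    have hsmul {s : S} {r : R} (hsr : s • one = r • one) (μ : DualModule θ T)
        (ν : DualModule (opSymm θ) T) :
        μ ((s • DualModule.transpose c.hom) ν) = ν ((r • c.hom) μ) := by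
      rw [LinearMap.smul_apply, LinearMap.smul_apply, ← c.hom_map r s hsr.symm,
        ← DualModule.apply_transpose]
      rfl
    constructor
    · intro s s' hss'
      obtain ⟨r, hr⟩ := c.regular.bijective_left.2 (s • one)
      obtain ⟨r', hr'⟩ := c.regular.bijective_left.2 (s' • one)
      have : r • c.hom = r' • c.hom :=
        LinearMap.ext fun μ => DualModule.eq_of_forall_apply_eq (opSymm θ) fun ν => by
          rw [← hsmul hr.symm, ← hsmul hr'.symm]
          exact congrArg μ (LinearMap.congr_fun hss' ν)
      rw [c.bijective.1 this] at hr
      exact c.regular.bijective_right.1 (hr.symm.trans hr')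
    · intro h
      obtain ⟨r, hr⟩ := c.bijective.2 (DualModule.transpose (θ := opSymm θ) h)
      obtain ⟨s, hs⟩ := c.regular.bijective_right.2 (r • one)
      refine ⟨s, LinearMap.ext fun ν => DualModule.eq_of_forall_apply_eq θ fun μ => ?_⟩
      calc μ ((s • DualModule.transpose c.hom) ν) = ν ((r • c.hom) μ) := hsmul hs μ ν
        _ = ν (DualModule.transpose (θ := opSymm θ) h μ) := congrArg ν (LinearMap.congr_fun hr μ)
        _ = μ (h ν) := DualModule.apply_transpose (θ := opSymm θ) h ν μ

theorem symm_symm [IsScalarTower K S T] [FiniteDimensional K T] (c : CanonicalHom θ one) :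
    c.symm.symm = c :=
  CanonicalHom.ext <| LinearMap.ext fun μ => DualModule.eq_of_forall_apply_eq (opSymm θ) fun ν =>
    (DualModule.apply_transpose (θ := opSymm θ) c.symm.hom ν μ).trans
      (DualModule.apply_transpose c.hom μ ν)

end CanonicalHom

end Comparison

section Resolution

theorem exists_injective_fin_of_faithful {K R S T E Y : Type u} [Field K] [Ring R] [Algebra K R]
    [Ring S] [AddCommGroup T] [Module R T] [Module S T] [SMulCommClass R S T] [SMulCommClass S R T]
    [AddCommGroup E] [Module K E] [Module R E] [IsScalarTower K R E] [FiniteDimensional K E]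
    [FaithfulSMul R E] [AddCommGroup Y] [Module K Y] [Module R Y] [IsScalarTower K R Y]
    [FiniteDimensional K Y] {one : T} (h : IsRegularBimodule R S one)
    (hY : Function.Injective (bidualEval R S T Y)) :
    ∃ (n : ℕ) (f : Y →ₗ[R] Fin n → E), Function.Injective f := by
  have hsep (y : Y) (hy : ∀ g : Y →ₗ[R] E, g y = 0) : y = 0 := by
    refine hY (LinearMap.ext fun φ => ?_)
    obtain ⟨r, hr⟩ := h.bijective_left.2 (φ y)
    have : r = 0 := FaithfulSMul.eq_of_smul_eq_smul fun x : E => by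
      have := hy (h.lift x ∘ₗ φ)
      rwa [LinearMap.comp_apply, ← hr, h.lift_smul_one, ← zero_smul R x] at this
    rw [bidualEval_apply, map_zero, LinearMap.zero_apply, ← hr, this]
    exact zero_smul R one
  have : Module.Finite K (Y →ₗ[R] E) :=
    .of_injective (LinearMap.restrictScalarsₗ K R Y E K) (LinearMap.restrictScalars_injective K)
  obtain ⟨n, b, hb⟩ := Module.Finite.exists_fin (R := K) (M := Y →ₗ[R] E)
  refine ⟨n, LinearMap.pi b, (injective_iff_map_eq_zero _).2 fun y hy => hsep y fun g => ?_⟩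
  have hle : Submodule.span K (Set.range b) ≤ LinearMap.ker (LinearMap.applyₗ' K y) := by
    rw [Submodule.span_le]
    rintro _ ⟨i, rfl⟩
    exact congrFun hy i
  exact hle (hb.ge (Submodule.mem_top (x := g)))

variable {R : Type u} [Ring R] {Y I : Type u} [AddCommGroup Y] [Module R Y]
  [AddCommGroup I] [Module R I]

theorem projective_fin [Module.Projective R I] (n : ℕ) : Module.Projective R (Fin n → I) :=
  .of_equiv (DFinsupp.linearEquivFunOnFintype (R := R) (M := fun _ : Fin n => I))

-- A free module containing `I` has a finitely generated free summand containing `Y`; the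
-- projection to it is injective on `I` because it is so on `Y`.
theorem finite_of_isEssential_range [IsNoetherianRing R] [Module.Finite R Y] [Module.Projective R I]
    {f : Y →ₗ[R] I} (hf : IsEssential (LinearMap.range f)) : Module.Finite R I := by
  classical
  obtain ⟨s, hs⟩ := Module.projective_def'.1 (inferInstance : Module.Projective R I)
  obtain ⟨G, hG⟩ := Module.Finite.fg_top (R := R) (M := Y)
  let t : Finset I := G.biUnion fun y => (s (f y)).support
  have hsupp (y : Y) : s (f y) ∈ Finsupp.supported R R (t : Set I) := by
    have hle : Submodule.span R (G : Set Y) ≤ (Finsupp.supported R R (t : Set I)).comap (s ∘ₗ f) :=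
      Submodule.span_le.2 fun y hy => Finset.coe_subset.2
        (Finset.subset_biUnion_of_mem (fun y => (s (f y)).support) hy)
    exact hle (hG.ge Submodule.mem_top)
  let p : I →ₗ[R] t → R := LinearMap.pi fun i => Finsupp.lapply i.1 ∘ₗ s
  have hp : LinearMap.ker p = ⊥ := by
    refine hf _ (eq_bot_iff.2 ?_)
    rintro _ ⟨hy, y, rfl⟩
    have : s (f y) = 0 := Finsupp.ext fun i => by
      by_contra hi
      exact hi (congrFun hy ⟨i, hsupp y (Finsupp.mem_support_iff.2 hi)⟩)
    have hsy : Finsupp.linearCombination R id (s (f y)) = f y := LinearMap.congr_fun hs (f y)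
    rw [← hsy, this, map_zero]
    exact Submodule.zero_mem ⊥
  exact Module.Finite.of_injective p (LinearMap.ker_eq_bot.1 hp)

/-- The minimal injective resolution of the first cosyzygy obtained by dropping the first term. -/
def MinimalInjectiveResolution.shift (J : MinimalInjectiveResolution R Y) :
    MinimalInjectiveResolution R (LinearMap.range (J.d 0)) where
  I n := J.I (n + 1)
  injective n := J.injective (n + 1)
  ι := (LinearMap.range (J.d 0)).subtype
  d n := J.d (n + 1)
  ι_injective := Subtype.val_injective
  exact_zero := by
    rw [LinearMap.exact_iff, Submodule.range_subtype]
    exact LinearMap.exact_iff.1 (J.exact_succ 0)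
  exact_succ n := J.exact_succ (n + 1)
  essential_zero := by
    rw [Submodule.range_subtype]
    exact J.essential_succ 0
  essential_succ n := J.essential_succ (n + 1)

theorem MinimalInjectiveResolution.exact_rangeRestrict (J : MinimalInjectiveResolution R Y) :
    Function.Exact J.ι (J.d 0).rangeRestrict := by
  rw [LinearMap.exact_iff, LinearMap.ker_rangeRestrict]
  exact LinearMap.exact_iff.1 J.exact_zero

theorem exists_resolution_of_lt_dominantDimension {n : ℕ} (h : n < dominantDimension R Y) :
    ∃ J : MinimalInjectiveResolution R Y, ∀ i ≤ n, Module.Projective R (J.I i) := by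
  obtain ⟨_, ⟨m, rfl, J, hJ⟩, hm⟩ := lt_sSup_iff.1 h
  exact ⟨J, fun i hi => hJ i (lt_of_le_of_lt hi (by exact_mod_cast hm))⟩

theorem dominantDimension_eq_top_of_projective (J : MinimalInjectiveResolution R Y)
    (hJ : ∀ i, Module.Projective R (J.I i)) : dominantDimension R Y = ⊤ := by
  rw [ENat.eq_top_iff_forall_ge]
  exact fun n => le_sSup ⟨n, rfl, J, fun i _ => hJ i⟩

theorem dominantDimension_eq_top_of_step {C : ModuleCat.{u} R → Prop}
    (step : ∀ X, C X → ∃ (I : ModuleCat.{u} R) (ι : X →ₗ[R] I), Module.Injective R I ∧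
      Module.Projective R I ∧ Function.Injective ι ∧ IsEssential (LinearMap.range ι) ∧
      C (ModuleCat.of R (I ⧸ LinearMap.range ι)))
    (X : ModuleCat.{u} R) (hX : C X) : dominantDimension R X = ⊤ := by
  choose I ι hinj hproj hι hess hC using step
  let Z : ℕ → {X // C X} := fun n => Nat.rec ⟨X, hX⟩ (fun _ X => ⟨_, hC X.1 X.2⟩) n
  let d (n : ℕ) : I (Z n).1 (Z n).2 →ₗ[R] I (Z (n + 1)).1 (Z (n + 1)).2 :=
    ι (Z (n + 1)).1 (Z (n + 1)).2 ∘ₗ (LinearMap.range (ι (Z n).1 (Z n).2)).mkQ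
  have hker (n) : LinearMap.ker (d n) = LinearMap.range (ι (Z n).1 (Z n).2) := by
    rw [LinearMap.ker_comp_of_ker_eq_bot _ (LinearMap.ker_eq_bot.2 (hι _ _)), Submodule.ker_mkQ]
  have hrange (n) : LinearMap.range (d n) = LinearMap.range (ι (Z (n + 1)).1 (Z (n + 1)).2) := by
    rw [LinearMap.range_comp, Submodule.range_mkQ, Submodule.map_top]
  exact dominantDimension_eq_top_of_projective {
    I := fun n => I (Z n).1 (Z n).2
    injective := fun n => hinj _ _
    ι := ι X hX
    d := d
    ι_injective := hι X hX
    exact_zero := LinearMap.exact_iff.2 (hker 0)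
    exact_succ := fun n => LinearMap.exact_iff.2 ((hker (n + 1)).trans (hrange n).symm)
    essential_zero := hess X hX
    essential_succ := fun n => by
      rw [hrange]
      exact hess _ _ } fun n => hproj _ _

end Resolution

section DominantDimension

/-- `R` is a QF-3 algebra: it has a finite dimensional module that is faithful, projective and
injective. Modules cogenerated by `R` embed into finite powers of such a module. -/
def IsQF3 (K R : Type u) [Field K] [Ring R] [Algebra K R] : Prop :=
  ∃ (E : Type u) (_ : AddCommGroup E) (_ : Module K E) (_ : Module R E) (_ : IsScalarTower K R E),
    FiniteDimensional K E ∧ FaithfulSMul R E ∧ Module.Injective R E ∧ Module.Projective R E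

theorem IsQF3.dual {K R S : Type u} [Field K] [Ring R] [Ring S] [Algebra K R] [Algebra K S]
    [FiniteDimensional K S] (θ : R ≃ₐ[K] Sᵐᵒᵖ) (h : IsQF3 K R) : IsQF3 K S := by
  obtain ⟨E, _, _, _, _, _, _, _, _⟩ := h
  exact ⟨DualModule θ E, inferInstance, inferInstance, inferInstance, inferInstance,
    inferInstance, inferInstance, DualModule.injective_of_projective,
    DualModule.projective_of_injective⟩

theorem IsQF3.exists_projective_injectiveHull {K R S T Y : Type u} [Field K] [Ring R] [Ring S]
    [Algebra K R] [AddCommGroup T] [Module R T] [Module S T] [SMulCommClass R S T]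
    [SMulCommClass S R T] {one : T} [AddCommGroup Y] [Module K Y] [Module R Y]
    [IsScalarTower K R Y] [FiniteDimensional K Y] (hR : IsQF3 K R)
    (h : IsRegularBimodule R S one) (hY : Function.Injective (bidualEval R S T Y)) :
    ∃ (I : Type u) (_ : AddCommGroup I) (_ : Module K I) (_ : Module R I)
      (_ : IsScalarTower K R I) (ι : Y →ₗ[R] I), FiniteDimensional K I ∧ Module.Injective R I ∧
      Module.Projective R I ∧ Function.Injective ι ∧ IsEssential (LinearMap.range ι) := by
  obtain ⟨E, _, _, _, _, _, _, _, _⟩ := hR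
  obtain ⟨n, f, hf⟩ := exists_injective_fin_of_faithful (K := K) (E := E) h hY
  have : IsArtinian R (Fin n → E) := isArtinian_of_tower K inferInstance
  have : IsNoetherian R (Fin n → E) := isNoetherian_of_tower K inferInstance
  have := projective_fin (R := R) (I := E) n
  obtain ⟨L, s, hs, hinj, hess⟩ := exists_essential_retract hf
  exact ⟨(Fin n → E) ⧸ L, inferInstance, inferInstance, inferInstance, inferInstance, L.mkQ ∘ₗ f,
    .of_surjective (L.mkQ.restrictScalars K) L.mkQ_surjective, injective_of_retract s L.mkQ hs,
    .of_split s L.mkQ hs, hinj, hess⟩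

namespace CanonicalHom

variable {K R S T : Type u} [Field K] [Ring R] [Ring S] [Algebra K R] [Algebra K S]
  {θ : R ≃ₐ[K] Sᵐᵒᵖ} [AddCommGroup T] [Module K T] [Module R T] [Module S T]
  [IsScalarTower K R T] [SMulCommClass R S T] [SMulCommClass S R T] {one : T}
  {Y : Type u} [AddCommGroup Y] [Module K Y] [Module R Y] [IsScalarTower K R Y]

theorem comparison_bijective_of_resolution [IsNoetherianRing R] [Module.Finite R Y]
    (c : CanonicalHom θ one) (J : MinimalInjectiveResolution R Y)
    (h₀ : Module.Projective R (J.I 0)) (h₁ : Module.Projective R (J.I 1)) :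
    Function.Bijective (c.comparison Y) := by
  let (n : ℕ) : Module K (J.I n) := Module.compHom _ (algebraMap K R)
  have (n : ℕ) : IsScalarTower K R (J.I n) := .of_algebraMap_smul fun _ _ => rfl
  have : Module.Finite R (J.I 0) := finite_of_isEssential_range J.essential_zero
  have : Module.Finite R (J.I 1) := finite_of_isEssential_range (J.essential_succ 0)
  exact c.comparison_bijective_of_exact J.ι_injective J.exact_zero
    c.comparison_bijective_of_projective c.comparison_bijective_of_projective.1

theorem subsingleton_ext_dualModule_of_resolution [FiniteDimensional K R] [FiniteDimensional K S]
    (c : CanonicalHom θ one) (n : ℕ) {X : Type u} [AddCommGroup X] [Module K X] [Module R X]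
    [IsScalarTower K R X] [FiniteDimensional K X] (J : MinimalInjectiveResolution R X)
    (hJ : ∀ i ≤ n + 2, Module.Projective R (J.I i)) :
    Subsingleton
      (Abelian.Ext.{u} (ModuleCat.of S (DualModule θ X)) (ModuleCat.of S T) (n + 1)) := by
  let (n : ℕ) : Module K (J.I n) := Module.compHom _ (algebraMap K R)
  have (n : ℕ) : IsScalarTower K R (J.I n) := .of_algebraMap_smul fun _ _ => rfl
  have := J.injective 0
  have := hJ 0 (by lia)
  have : IsNoetherianRing R := isNoetherian_of_tower K inferInstance
  have : Module.Finite R X := .of_restrictScalars_finite K R X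
  have : Module.Finite R (J.I 0) := finite_of_isEssential_range J.essential_zero
  have : FiniteDimensional K (J.I 0) := Module.Finite.trans R _
  have : FiniteDimensional K (LinearMap.range (J.d 0)) := Module.Finite.trans R _
  have : Module.Projective S (DualModule θ (J.I 0)) := DualModule.projective_of_injective
  have hsurj := (J.d 0).surjective_rangeRestrict
  have hi := DualModule.map_injective (θ := θ) hsurj
  have hp := DualModule.map_surjective (θ := θ) J.ι_injective
  have hip := DualModule.map_exact (θ := θ) J.exact_rangeRestrict
  cases n with
  | zero =>
    rw [subsingleton_ext_one_iff hi hp hip,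
      ← c.comparison_surjective_iff hsurj c.comparison_bijective_of_projective.2]
    exact (c.comparison_bijective_of_resolution J.shift (hJ 1 (by lia)) (hJ 2 (by lia))).2
  | succ n =>
    rw [subsingleton_ext_succ_iff hi hp hip]
    exact c.subsingleton_ext_dualModule_of_resolution n J.shift fun i hi => hJ (i + 1) (by lia)

theorem dominantDimension_eq_top_of_comparison_bijective [FiniteDimensional K S]
    [FiniteDimensional K Y] (hR : IsQF3 K R) (c : CanonicalHom θ one)
    (hY : Function.Bijective (c.comparison Y)) (hext : ExtVanishes S (DualModule θ Y) T) :
    dominantDimension R Y = ⊤ := by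
  let C (X : ModuleCat.{u} R) : Prop := ∃ (_ : Module K X) (_ : IsScalarTower K R X),
    FiniteDimensional K X ∧ Function.Bijective (c.comparison X) ∧ ExtVanishes S (DualModule θ X) T
  refine dominantDimension_eq_top_of_step (C := C) ?_ (ModuleCat.of R Y)
    ⟨inferInstance, inferInstance, inferInstance, hY, hext⟩
  rintro X ⟨_, _, _, hX, hext⟩
  obtain ⟨I, _, _, _, _, ι, _, _, _, hι, hess⟩ :=
    hR.exists_projective_injectiveHull c.regular (c.comparison_injective_iff.1 hX.1)
  have hsurj := Submodule.mkQ_surjective (LinearMap.range ι)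
  have hex : Function.Exact ι (LinearMap.range ι).mkQ := LinearMap.exact_map_mkQ_range ι
  have : Module.Finite R I := .of_restrictScalars_finite K R I
  have hI := c.comparison_bijective_of_projective (Y := I)
  have : Module.Projective S (DualModule θ I) := DualModule.projective_of_injective
  rw [extVanishes_iff_of_exact (DualModule.map_injective hsurj) (DualModule.map_surjective hι)
    (DualModule.map_exact hex), ← c.comparison_surjective_iff hsurj hI.2] at hext
  exact ⟨ModuleCat.of R I, ι, ‹_›, ‹_›, hι, hess, inferInstance, inferInstance,
    .of_surjective ((LinearMap.range ι).mkQ.restrictScalars K) hsurj,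
    ⟨c.comparison_injective_of_exact hι hex hsurj hX.2 hI.1, hext.1⟩, hext.2⟩

variable (Y) in
theorem dominantDimension_eq_top_iff [FiniteDimensional K R] [FiniteDimensional K S]
    [FiniteDimensional K Y] (hR : IsQF3 K R) (c : CanonicalHom θ one) :
    dominantDimension R Y = ⊤ ↔
      Function.Bijective (c.comparison Y) ∧ ExtVanishes S (DualModule θ Y) T := by
  refine ⟨fun h => ?_, fun h => c.dominantDimension_eq_top_of_comparison_bijective hR h.1 h.2⟩
  have hJ (n : ℕ) := exists_resolution_of_lt_dominantDimension (h ▸ ENat.natCast_lt_top n)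
  constructor
  · obtain ⟨J, hJ⟩ := hJ 1
    have : IsNoetherianRing R := isNoetherian_of_tower K inferInstance
    have : Module.Finite R Y := .of_restrictScalars_finite K R Y
    exact c.comparison_bijective_of_resolution J (hJ 0 zero_le_one) (hJ 1 le_rfl)
  · intro n hn
    obtain ⟨n, rfl⟩ := Nat.exists_eq_add_of_le' hn
    obtain ⟨J, hJ⟩ := hJ (n + 2)
    exact c.subsingleton_ext_dualModule_of_resolution n J hJ

end CanonicalHom

end DominantDimension

section TotallyReflexive

/-- `X` is totally reflexive with respect to the regular bimodule `T`. A module is Gorenstein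
projective exactly if it is totally reflexive, and this form does not mention presentations. -/
structure IsTotallyReflexive (R S T X : Type u) [Ring R] [Ring S] [AddCommGroup T] [Module R T]
    [Module S T] [SMulCommClass R S T] [SMulCommClass S R T] [AddCommGroup X] [Module R X] :
    Prop where
  ext : ExtVanishes R X T
  bijective : Function.Bijective (bidualEval R S T X)
  ext_hom : ExtVanishes S (X →ₗ[R] T) T

theorem IsRegularBimodule.isTotallyReflexive_iff {R S T X : Type u} [Ring R] [Ring S]
    [AddCommGroup T] [Module R T] [Module S T] [SMulCommClass R S T] [SMulCommClass S R T]
    [AddCommGroup X] [Module R X] [IsArtinianRing R] [Module.Finite R X] {one : T}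
    (h : IsRegularBimodule R S one) :
    IsTotallyReflexive R S T X ↔
      ExtVanishes R X T ∧
        ∃ P : MinimalProjectivePresentation R X, ExtVanishes S (P.Transpose S T) T := by
  constructor
  · rintro ⟨hX, hbij, hhom⟩
    obtain ⟨P⟩ := exists_minimalProjectivePresentation R X
    exact ⟨hX, P, (h.extVanishes_transpose_iff P).2 ⟨hbij, hhom⟩⟩
  · rintro ⟨hX, P, hP⟩
    obtain ⟨hbij, hhom⟩ := (h.extVanishes_transpose_iff P).1 hP
    exact ⟨hX, hbij, hhom⟩

namespace CanonicalHom

variable {K R S T : Type u} [Field K] [Ring R] [Ring S] [Algebra K R] [Algebra K S]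
  {θ : R ≃ₐ[K] Sᵐᵒᵖ} [AddCommGroup T] [Module K T] [Module R T] [Module S T]
  [IsScalarTower K R T] [IsScalarTower K S T] [SMulCommClass R S T] [SMulCommClass S R T]
  [FiniteDimensional K T] {one : T} {X : Type u} [AddCommGroup X] [Module K X] [Module R X]
  [IsScalarTower K R X] [FiniteDimensional K X]

theorem comparison_bijective_of_bidualEval (c : CanonicalHom θ one)
    (hX : Function.Bijective (bidualEval R S T X)) : Function.Bijective (c.comparison X) := by
  have : Module.Finite K (X →ₗ[R] T) :=
    .of_injective (LinearMap.restrictScalarsₗ K R X T K) (LinearMap.restrictScalars_injective K)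
  have : Module.Finite S (X →ₗ[R] T) := .of_restrictScalars_finite K S _
  exact c.comparison_bijective_of_linearEquiv (.ofBijective _ hX) c.comparison_hom_bijective

/-- If the comparison map of `D(X)` is bijective, then it identifies `D(X)` with the `T`-dual
of `X`. -/
noncomputable def dualEquivHom (c : CanonicalHom θ one)
    (hD : Function.Bijective (c.symm.comparison (DualModule θ X))) :
    DualModule θ X ≃ₗ[S] X →ₗ[R] T :=
  LinearEquiv.ofBijective (c.symm.comparison (DualModule θ X)) hD ≪≫ₗ
    LinearEquiv.congrLeft T S (DualModule.evalEquiv θ X).symm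

theorem bidualEval_bijective_of_comparison (c : CanonicalHom θ one)
    (hX : Function.Bijective (c.comparison X))
    (hD : Function.Bijective (c.symm.comparison (DualModule θ X))) :
    Function.Bijective (bidualEval R S T X) := by
  let e : X ≃ₗ[R] (X →ₗ[R] T) →ₗ[S] T :=
    .ofBijective (c.comparison X) hX ≪≫ₗ LinearEquiv.congrLeft T R (c.dualEquivHom hD)
  have : IsArtinian R X := isArtinian_of_tower K inferInstance
  have hinj : Function.Injective (e.symm.toLinearMap ∘ₗ bidualEval R S T X) :=
    e.symm.injective.comp (c.comparison_injective_iff.1 hX.1)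
  exact (Function.Bijective.of_comp_iff' e.symm.bijective _).1
    (IsArtinian.bijective_of_injective_endomorphism _ hinj)

theorem isTotallyReflexive_of_comparison (c : CanonicalHom θ one)
    (hX : Function.Bijective (c.comparison X))
    (hD : Function.Bijective (c.symm.comparison (DualModule θ X)))
    (hextX : ExtVanishes R X T) (hextD : ExtVanishes S (DualModule θ X) T) :
    IsTotallyReflexive R S T X where
  ext := hextX
  bijective := c.bidualEval_bijective_of_comparison hX hD
  ext_hom := hextD.of_linearEquiv (c.dualEquivHom hD)

theorem isTotallyReflexive_and_dual_iff [FiniteDimensional K R] [FiniteDimensional K S]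
    (hR : IsQF3 K R) (c : CanonicalHom θ one) :
    IsTotallyReflexive R S T X ∧ IsTotallyReflexive S R T (DualModule θ X) ↔
      dominantDimension R X = ⊤ ∧ dominantDimension S (DualModule θ X) = ⊤ := by
  let e := DualModule.evalEquiv θ X
  rw [c.dominantDimension_eq_top_iff X hR,
    c.symm.dominantDimension_eq_top_iff (DualModule θ X) (hR.dual θ)]
  constructor
  · rintro ⟨hX, hD⟩
    exact ⟨⟨c.comparison_bijective_of_bidualEval hX.bijective, hD.ext⟩,
      c.symm.comparison_bijective_of_bidualEval hD.bijective, hX.ext.of_linearEquiv e⟩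
  · rintro ⟨⟨hX, hextD⟩, hD, hextX⟩
    have hDD : Function.Bijective
        (c.symm.symm.comparison (DualModule (opSymm θ) (DualModule θ X))) := by
      rw [c.symm_symm]
      exact c.comparison_bijective_of_linearEquiv e.symm hX
    exact ⟨c.isTotallyReflexive_of_comparison hX hD (hextX.of_linearEquiv e.symm) hextD,
      c.symm.isTotallyReflexive_of_comparison hD hDD hextD hextX⟩

end CanonicalHom

end TotallyReflexive

section Corner

theorem exists_injective_pi_of_faithful (R E P : Type u) [Ring R] [AddCommGroup E] [Module R E]
    [FaithfulSMul R E] [AddCommGroup P] [Module R P] [Module.Projective R P] :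
    ∃ f : P →ₗ[R] P × E → E, Function.Injective f := by
  obtain ⟨s, hs⟩ := Module.projective_def'.1 (inferInstance : Module.Projective R P)
  refine ⟨LinearMap.pi fun i => (LinearMap.toSpanSingleton R E i.2) ∘ₗ Finsupp.lapply i.1 ∘ₗ s,
    fun p q hpq => (LinearMap.injective_of_comp_eq_id s _ hs) (Finsupp.ext fun i => ?_)⟩
  exact FaithfulSMul.eq_of_smul_eq_smul fun x : E => congrFun hpq (i, x)

variable {A : Type u} [Ring A] (e : A) (X : Type u) [AddCommGroup X] [Module Aᵐᵒᵖ X]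

/-- No nonzero element of the right module `X` is annihilated by `A e`; equivalently, the natural
map `X → Hom_{eAe}(A e, X e)` is injective. -/
def IsCornerFaithful : Prop :=
  ∀ x : X, (∀ a : A, op (a * e) • x = 0) → x = 0

/-- The natural map `X → Hom_{eAe}(A e, X e)` is surjective. A homomorphism `A e → X e` is
represented by an additive map on `A`, of which only the values on `A e` matter. -/
def IsCornerComplete : Prop :=
  ∀ φ : A →+ X, (∀ a b, φ (a * (e * b * e)) = op (e * b * e) • φ a) →
    ∃ x : X, ∀ a, φ (a * e) = op (a * e) • x

variable {e X} {Y Z : Type u} [AddCommGroup Y] [Module Aᵐᵒᵖ Y] [AddCommGroup Z] [Module Aᵐᵒᵖ Z]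

namespace IsCornerFaithful

theorem of_injective (h : IsCornerFaithful e Y) {f : X →ₗ[Aᵐᵒᵖ] Y} (hf : Function.Injective f) :
    IsCornerFaithful e X := fun x hx =>
  hf <| by
    rw [map_zero]
    exact h _ fun a => by rw [← map_smul, hx, map_zero]

theorem pi {ι : Type u} {X : ι → Type u} [∀ i, AddCommGroup (X i)] [∀ i, Module Aᵐᵒᵖ (X i)]
    (h : ∀ i, IsCornerFaithful e (X i)) : IsCornerFaithful e (∀ i, X i) :=
  fun _ hx => funext fun i => h i _ fun a => congrFun (hx a) i

theorem of_projective (h : IsCornerFaithful e Y) [FaithfulSMul Aᵐᵒᵖ Y]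
    [Module.Projective Aᵐᵒᵖ X] : IsCornerFaithful e X := by
  obtain ⟨f, hf⟩ := exists_injective_pi_of_faithful Aᵐᵒᵖ Y X
  exact (pi fun _ => h).of_injective hf

end IsCornerFaithful

namespace IsCornerComplete

theorem pi {ι : Type u} {X : ι → Type u} [∀ i, AddCommGroup (X i)] [∀ i, Module Aᵐᵒᵖ (X i)]
    (h : ∀ i, IsCornerComplete e (X i)) : IsCornerComplete e (∀ i, X i) := by
  intro φ hφ
  choose x hx using fun i => h i ((Pi.evalAddMonoidHom X i).comp φ) fun a b => congrFun (hφ a b) i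
  exact ⟨x, fun a => funext fun i => hx i a⟩

theorem of_retract (h : IsCornerComplete e Y) {f : X →ₗ[Aᵐᵒᵖ] Y} {g : Y →ₗ[Aᵐᵒᵖ] X}
    (hgf : g ∘ₗ f = LinearMap.id) : IsCornerComplete e X := by
  intro φ hφ
  obtain ⟨y, hy⟩ := h (f.toAddMonoidHom.comp φ) fun a b =>
    (congrArg f (hφ a b)).trans (map_smul f _ _)
  refine ⟨g y, fun a => ?_⟩
  rw [← map_smul, ← hy]
  exact (LinearMap.congr_fun hgf _).symm

theorem of_exact (h : IsCornerComplete e Y) (hZ : IsCornerFaithful e Z) {f : X →ₗ[Aᵐᵒᵖ] Y}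
    {g : Y →ₗ[Aᵐᵒᵖ] Z} (hf : Function.Injective f) (hfg : Function.Exact f g) :
    IsCornerComplete e X := by
  intro φ hφ
  obtain ⟨y, hy⟩ := h (f.toAddMonoidHom.comp φ) fun a b =>
    (congrArg f (hφ a b)).trans (map_smul f _ _)
  have hgy : g y = 0 := hZ _ fun a => by
    rw [← map_smul, ← hy]
    exact hfg.apply_apply_eq_zero _
  obtain ⟨x, rfl⟩ := (hfg y).1 hgy
  exact ⟨x, fun a => hf ((hy a).trans (map_smul f _ _).symm)⟩

theorem of_projective_of_injective (h : IsCornerComplete e Y) [FaithfulSMul Aᵐᵒᵖ Y]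
    [Module.Projective Aᵐᵒᵖ X] [Module.Injective Aᵐᵒᵖ X] : IsCornerComplete e X := by
  obtain ⟨f, hf⟩ := exists_injective_pi_of_faithful Aᵐᵒᵖ Y X
  obtain ⟨g, hgf⟩ := Module.Injective.extension_property Aᵐᵒᵖ _ _ _ f hf LinearMap.id
  exact (pi fun _ => h).of_retract hgf

theorem of_two_le_dominantDimension (h : IsCornerComplete e Y) (hY : IsCornerFaithful e Y)
    [FaithfulSMul Aᵐᵒᵖ Y] (hX : 2 ≤ dominantDimension Aᵐᵒᵖ X) : IsCornerComplete e X := by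
  obtain ⟨J, hJ⟩ := exists_resolution_of_lt_dominantDimension (n := 1)
    (lt_of_lt_of_le (by norm_num) hX)
  have := hJ 0 zero_le_one
  have := hJ 1 le_rfl
  have := J.injective 0
  exact (of_projective_of_injective h).of_exact hY.of_projective J.ι_injective J.exact_zero

end IsCornerComplete

end Corner

section Trace

variable {K A : Type u} [Field K] [Ring A] [Algebra K A] {e : A}

theorem mem_leftIdeal_iff (he : IsIdempotentElem e) {x : A} : x ∈ leftIdeal e ↔ x * e = x := by
  rw [Submodule.mem_span_singleton]
  constructor
  · rintro ⟨a, rfl⟩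
    rw [smul_eq_mul, mul_assoc, he.eq]
  · exact fun h => ⟨x, h⟩

theorem mem_rightIdeal_iff (he : IsIdempotentElem e) {x : A} : x ∈ rightIdeal e ↔ e * x = x := by
  rw [Submodule.mem_span_singleton]
  constructor
  · rintro ⟨a, rfl⟩
    rw [MulOpposite.smul_eq_mul_unop, ← mul_assoc, he.eq]
  · exact fun h => ⟨op x, h⟩

namespace DualBimoduleIso

/-- The linear form on `A e` that corresponds to `e` under `D(A e) ≅ e A`, extended to `A` along
right multiplication by `e`. It restricts to a symmetrizing form of `e A e`. -/
noncomputable def trace (ι : DualBimoduleIso K e) : A →ₗ[K] K :=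
  ι.toEquiv.symm ⟨e, Submodule.mem_span_singleton_self e⟩ ∘ₗ
    (LinearMap.toSpanSingleton A (leftIdeal e)
      ⟨e, Submodule.mem_span_singleton_self e⟩).restrictScalars K

theorem trace_apply (he : IsIdempotentElem e) (ι : DualBimoduleIso K e) (y : leftIdeal e) :
    ι.trace y = ι.toEquiv.symm ⟨e, Submodule.mem_span_singleton_self e⟩ y :=
  congrArg (ι.toEquiv.symm ⟨e, Submodule.mem_span_singleton_self e⟩)
    (Subtype.ext ((mem_leftIdeal_iff he).1 y.2))

theorem trace_mul_idem (he : IsIdempotentElem e) (ι : DualBimoduleIso K e) (a : A) :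
    ι.trace (a * e) = ι.trace a :=
  ι.trace_apply he ⟨a * e, Submodule.mem_span_singleton.2 ⟨a, rfl⟩⟩

theorem symm_apply (he : IsIdempotentElem e) (ι : DualBimoduleIso K e) (x : rightIdeal e)
    (y : leftIdeal e) : ι.toEquiv.symm x y = ι.trace (x * y) := by
  have hx : x = ι.toEquiv (ι.toEquiv.symm ⟨e, Submodule.mem_span_singleton_self e⟩ ∘ₗ
      Algebra.lsmul K K (leftIdeal e) (x : A)) := Subtype.ext (by
    rw [ι.map_right, LinearEquiv.apply_symm_apply, (mem_rightIdeal_iff he).1 x.2])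
  conv_lhs => rw [hx, LinearEquiv.symm_apply_apply]
  exact (ι.trace_apply he ((x : A) • y)).symm

theorem trace_corner_mul (he : IsIdempotentElem e) (ι : DualBimoduleIso K e) (y : leftIdeal e)
    (b : A) : ι.trace (e * b * e * y) = ι.trace (y * (e * b * e)) := by
  have hmem : e * b * e ∈ rightIdeal e :=
    (mem_rightIdeal_iff he).2 (by rw [← mul_assoc, ← mul_assoc, he.eq])
  have hx : (⟨e * b * e, hmem⟩ : rightIdeal e) =
      ι.toEquiv (ι.toEquiv.symm ⟨e, Submodule.mem_span_singleton_self e⟩ ∘ₗ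
        mulRightCorner K e b) := Subtype.ext (by
    rw [ι.map_left, LinearEquiv.apply_symm_apply]
    exact (he.mul_mul_self _).symm)
  rw [← ι.symm_apply he ⟨e * b * e, hmem⟩ y, hx, LinearEquiv.symm_apply_apply]
  exact (ι.trace_apply he (mulRightCorner K e b y)).symm

theorem trace_idem_mul (he : IsIdempotentElem e) (ι : DualBimoduleIso K e) (a : A) :
    ι.trace (e * a) = ι.trace a := by
  have hy : a * e ∈ leftIdeal e := Submodule.mem_span_singleton.2 ⟨a, rfl⟩
  have := ι.trace_corner_mul he ⟨a * e, hy⟩ 1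
  simp only [mul_one, he.eq, he.mul_mul_self] at this
  rwa [← mul_assoc, ι.trace_mul_idem he, ι.trace_mul_idem he] at this

theorem trace_mul_comm (he : IsIdempotentElem e) (ι : DualBimoduleIso K e) (a b : A) :
    ι.trace (a * e * b) = ι.trace (b * e * a) := by
  have hy : b * e ∈ leftIdeal e := Submodule.mem_span_singleton.2 ⟨b, rfl⟩
  calc ι.trace (a * e * b) = ι.trace (e * a * e * (b * e)) := by
        rw [← mul_assoc, ι.trace_mul_idem he, mul_assoc e, mul_assoc e, ι.trace_idem_mul he]
    _ = ι.trace (b * e * (e * a * e)) := ι.trace_corner_mul he ⟨b * e, hy⟩ a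
    _ = ι.trace (b * e * a) := by
        rw [← mul_assoc, ι.trace_mul_idem he, ← mul_assoc, he.mul_mul_self]

theorem exists_trace_mul_left_eq (he : IsIdempotentElem e) (ι : DualBimoduleIso K e)
    (F : A →ₗ[K] K) : ∃ t, ∀ a, ι.trace (t * a) = F (a * e) := by
  let x := ι.toEquiv (F ∘ₗ (leftIdeal e).subtype.restrictScalars K)
  refine ⟨x, fun a => ?_⟩
  have hy : a * e ∈ leftIdeal e := Submodule.mem_span_singleton.2 ⟨a, rfl⟩
  rw [← ι.trace_mul_idem he, mul_assoc, ← ι.symm_apply he x ⟨a * e, hy⟩,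
    LinearEquiv.symm_apply_apply]
  rfl

theorem exists_trace_mul_right_eq [FiniteDimensional K A] (he : IsIdempotentElem e)
    (ι : DualBimoduleIso K e) (F : A →ₗ[K] K) : ∃ t, ∀ a, ι.trace (a * t) = F (e * a) := by
  let G : Module.Dual K (Module.Dual K (leftIdeal e)) :=
    F ∘ₗ (rightIdeal e).subtype.restrictScalars K ∘ₗ ι.toEquiv.toLinearMap
  let y := (Module.evalEquiv K (leftIdeal e)).symm G
  refine ⟨y, fun a => ?_⟩
  have hx : e * a ∈ rightIdeal e := Submodule.mem_span_singleton.2 ⟨op a, rfl⟩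
  calc ι.trace (a * y) = ι.trace (e * a * y) := by rw [mul_assoc, ι.trace_idem_mul he]
    _ = ι.toEquiv.symm ⟨e * a, hx⟩ y := (ι.symm_apply he ⟨e * a, hx⟩ y).symm
    _ = G (ι.toEquiv.symm ⟨e * a, hx⟩) :=
        Module.apply_evalEquiv_symm_apply (R := K) (M := leftIdeal e) _ G
    _ = F (e * a) := congrArg (fun z : rightIdeal e => F z) (ι.toEquiv.apply_symm_apply _)

theorem idem_mul_eq_of_trace (he : IsIdempotentElem e) (ι : DualBimoduleIso K e) {s t : A}
    (hst : ∀ a, ι.trace (s * a) = ι.trace (t * a)) : e * s = e * t := by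
  have hmem (t : A) : e * t ∈ rightIdeal e := Submodule.mem_span_singleton.2 ⟨op t, rfl⟩
  have : ι.toEquiv.symm ⟨e * s, hmem s⟩ = ι.toEquiv.symm ⟨e * t, hmem t⟩ :=
    LinearMap.ext fun y => by
      rw [ι.symm_apply he, ι.symm_apply he, mul_assoc, mul_assoc, ι.trace_idem_mul he,
        ι.trace_idem_mul he, hst]
  exact congrArg Subtype.val (ι.toEquiv.symm.injective this)

theorem mul_idem_eq_of_trace (he : IsIdempotentElem e) (ι : DualBimoduleIso K e) {s t : A}
    (hst : ∀ a, ι.trace (a * s) = ι.trace (a * t)) : s * e = t * e := by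
  refine sub_eq_zero.1 ((Module.forall_dual_apply_eq_zero_iff K _).1 fun F => ?_)
  obtain ⟨x, hx⟩ := ι.exists_trace_mul_left_eq he F
  rw [map_sub, ← hx, ← hx, hst, sub_self]

theorem eq_of_trace [FaithfulSMul Aᵐᵒᵖ (rightIdeal e)] (he : IsIdempotentElem e)
    (ι : DualBimoduleIso K e) {s t : A} (hst : ∀ a b, ι.trace (a * s * b) = ι.trace (a * t * b)) :
    s = t := by
  refine op_injective (FaithfulSMul.eq_of_smul_eq_smul fun x : rightIdeal e => Subtype.ext ?_)
  have := ι.idem_mul_eq_of_trace he (hst x)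
  rwa [← mul_assoc, ← mul_assoc, (mem_rightIdeal_iff he).1 x.2] at this

theorem isCornerFaithful_rightIdeal (he : IsIdempotentElem e) (ι : DualBimoduleIso K e) :
    IsCornerFaithful e (rightIdeal e) := fun x hx => Subtype.ext <| by
  calc (x : A) = e * x := ((mem_rightIdeal_iff he).1 x.2).symm
    _ = e * 0 := ι.idem_mul_eq_of_trace he fun a => by
        have : (x : A) * (a * e) = 0 := congrArg Subtype.val (hx a)
        rw [← ι.trace_mul_idem he, mul_assoc, this, zero_mul]
    _ = 0 := mul_zero e

theorem isCornerComplete_rightIdeal (he : IsIdempotentElem e) (ι : DualBimoduleIso K e) :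
    IsCornerComplete e (rightIdeal e) := by
  intro φ hφ
  have hcorner (a b : A) : (φ (a * (e * b * e)) : A) = φ a * (e * b * e) :=
    congrArg Subtype.val (hφ a b)
  have hφe (a : A) : (φ (a * e) : A) = φ a * e := by simpa [he.eq] using hcorner a 1
  let F : A →ₗ[K] K :=
    { toFun := fun a => ι.trace (φ (a * e))
      map_add' := fun a b => by simp [add_mul]
      map_smul' := fun k a => by
        have := hcorner a (k • 1)
        simp only [mul_smul_comm, smul_mul_assoc, mul_one, he.eq] at this ⊢
        rw [this, hφe, map_smul, RingHom.id_apply] }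
  obtain ⟨t, ht⟩ := ι.exists_trace_mul_left_eq he F
  have hmem : e * t ∈ rightIdeal e := Submodule.mem_span_singleton.2 ⟨op t, rfl⟩
  refine ⟨⟨e * t, hmem⟩, fun a => Subtype.ext ?_⟩
  calc (φ (a * e) : A) = e * φ (a * e) := ((mem_rightIdeal_iff he).1 (φ (a * e)).2).symm
    _ = e * (t * (a * e)) := ι.idem_mul_eq_of_trace he fun b => by
        rw [mul_assoc t, ht, hφe, ← ι.trace_mul_idem he, mul_assoc, mul_assoc, ← mul_assoc e,
          ← hcorner]
        simp only [F, LinearMap.coe_mk, AddHom.coe_mk, mul_assoc, he.eq]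
    _ = e * t * (a * e) := (mul_assoc _ _ _).symm

end DualBimoduleIso

end Trace

section GendoSymmetric

variable {K A : Type u} [Field K] [Ring A] [Algebra K A] {e : A}

theorem isRegularBimodule_op (A : Type u) [Ring A] : IsRegularBimodule Aᵐᵒᵖ A (1 : A) where
  bijective_left := by simpa [MulOpposite.smul_eq_mul_unop] using unop_bijective
  bijective_right := by simpa [Function.id_def] using Function.bijective_id (α := A)

theorem isQF3_of_two_le_dominantDimension [FiniteDimensional K A]
    (hA : 2 ≤ dominantDimension Aᵐᵒᵖ A) : IsQF3 K Aᵐᵒᵖ := by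
  obtain ⟨J, hJ⟩ := exists_resolution_of_lt_dominantDimension (n := 0)
    (lt_of_lt_of_le (by norm_num) hA)
  have : FiniteDimensional K Aᵐᵒᵖ := Module.Finite.equiv (opLinearEquiv K)
  have : IsNoetherianRing Aᵐᵒᵖ := isNoetherian_of_tower K inferInstance
  have : Module.Finite Aᵐᵒᵖ A := .of_restrictScalars_finite K _ _
  have := hJ 0 le_rfl
  have : Module.Finite Aᵐᵒᵖ (J.I 0) := finite_of_isEssential_range J.essential_zero
  let : Module K (J.I 0) := Module.compHom _ (algebraMap K Aᵐᵒᵖ)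
  have : IsScalarTower K Aᵐᵒᵖ (J.I 0) := .of_algebraMap_smul fun _ _ => rfl
  refine ⟨J.I 0, inferInstance, inferInstance, inferInstance, inferInstance,
    Module.Finite.trans Aᵐᵒᵖ _, ⟨fun {r s} h => ?_⟩, J.injective 0, hJ 0 le_rfl⟩
  refine (isRegularBimodule_op A).bijective_left.1 (J.ι_injective ?_)
  rw [map_smul, map_smul, h]

/-- The dual `D(A) = Hom_K(A, K)` of the right `A`-module `A`, a left `A`-module. -/
abbrev DualAlgebra (K A : Type u) [Field K] [Ring A] [Algebra K A] : Type u :=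
  DualModule (AlgEquiv.refl : Aᵐᵒᵖ ≃ₐ[K] Aᵐᵒᵖ) A

namespace DualBimoduleIso

variable [FiniteDimensional K A]

theorem exists_trace_eq (he : IsIdempotentElem e) (ι : DualBimoduleIso K e)
    (hA : IsCornerComplete e A) (μ : DualAlgebra K A) :
    ∃ w, ∀ a b, ι.trace (a * w * b) = μ (b * e * a) := by
  choose ψ hψ using fun b => show ∃ t, ∀ a, ι.trace (a * t) = μ (b * (e * a)) from
    ι.exists_trace_mul_right_eq he (LinearMap.comp μ (LinearMap.mulLeft K b))
  let φ : A →+ A := AddMonoidHom.mk' (fun b => ψ b * e) fun b c => by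
    rw [← add_mul]
    exact ι.mul_idem_eq_of_trace he fun a => by simp only [mul_add, add_mul, map_add, hψ]
  obtain ⟨w, hw⟩ := hA φ fun b s => by
    have : ψ (b * (e * s * e)) * e = ψ b * e * s * e := ι.mul_idem_eq_of_trace he fun a => by
      calc ι.trace (a * ψ (b * (e * s * e))) = ι.trace (s * e * a * ψ b) := by
            rw [hψ, hψ]
            simp only [mul_assoc, he.mul_self_mul]
        _ = ι.trace (a * (ψ b * e * s)) := by
            rw [mul_assoc (s * e), ← ι.trace_mul_comm he, ← mul_assoc, ← mul_assoc]
    calc ψ (b * (e * s * e)) * e = ψ b * e * (e * s * e) := by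
          rw [this]
          simp only [mul_assoc, he.mul_self_mul]
      _ = op (e * s * e) • φ b := rfl
  refine ⟨w, fun a b => ?_⟩
  have hwb : ψ (b * e) * e = w * (b * e) := hw b
  calc ι.trace (a * w * b) = ι.trace (a * ψ (b * e)) := by
        rw [← ι.trace_mul_idem he, mul_assoc, mul_assoc, ← hwb, ← mul_assoc, ι.trace_mul_idem he]
    _ = μ (b * e * a) := by rw [hψ, mul_assoc, he.mul_self_mul, mul_assoc]

theorem exists_trace_hom_eq (he : IsIdempotentElem e) (ι : DualBimoduleIso K e)
    (hA : IsCornerComplete e A) (h : DualAlgebra K A →ₗ[A] A) :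
    ∃ c, ∀ μ a b, ι.trace (a * h μ * b) = μ (c * (b * e) * a) := by
  let φ : A →+ A := (DualModule.transpose h).toAddMonoidHom.comp
    ((LinearMap.mul K A).flip.compr₂ ι.trace).toAddMonoidHom
  have hφ (μ : DualAlgebra K A) (b : A) : μ (φ b) = ι.trace (h μ * b) :=
    DualModule.apply_transpose h μ _
  have hφmul (μ : DualAlgebra K A) (a b : A) : μ (φ b * a) = ι.trace (a * h μ * b) := by
    rw [← smul_eq_mul a, ← map_smul, ← hφ]
    rfl
  obtain ⟨c, hc⟩ := hA φ fun b s => DualModule.eq_of_forall_apply_eq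
      (AlgEquiv.refl : Aᵐᵒᵖ ≃ₐ[K] Aᵐᵒᵖ) fun μ => by
    calc μ (φ (b * (e * s * e))) = ι.trace (h μ * b * e * s) := by
          rw [hφ, ← ι.trace_mul_idem he (h μ * b * e * s)]
          simp only [mul_assoc]
      _ = ι.trace (e * s * e * h μ * b) := by
          rw [ι.trace_mul_comm he, mul_assoc e s, mul_assoc e, mul_assoc e, ι.trace_idem_mul he,
            mul_assoc _ _ b]
      _ = μ (op (e * s * e) • φ b) := (hφmul μ _ b).symm
  refine ⟨c, fun μ a b => ?_⟩
  have hcb : φ (b * e) = c * (b * e) := hc b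
  rw [← hcb, hφmul, ← mul_assoc, ι.trace_mul_idem he]

variable [FaithfulSMul Aᵐᵒᵖ (rightIdeal e)]

/-- The bimodule homomorphism `ω : D(A) → A` with `trace (a * ω μ * b) = μ (b * e * a)`. -/
noncomputable def canonicalMap (he : IsIdempotentElem e) (ι : DualBimoduleIso K e)
    (hA : IsCornerComplete e A) : DualAlgebra K A →ₗ[A] A where
  toFun μ := (ι.exists_trace_eq he hA μ).choose
  map_add' μ ν := ι.eq_of_trace he fun a b => by
    rw [mul_add, add_mul, map_add, (ι.exists_trace_eq he hA (μ + ν)).choose_spec,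
      (ι.exists_trace_eq he hA μ).choose_spec, (ι.exists_trace_eq he hA ν).choose_spec]
    rfl
  map_smul' s μ := ι.eq_of_trace he fun a b => by
    rw [smul_eq_mul, RingHom.id_apply, ← mul_assoc, (ι.exists_trace_eq he hA (s • μ)).choose_spec,
      (ι.exists_trace_eq he hA μ).choose_spec, ← mul_assoc]
    rfl

theorem trace_mul_canonicalMap_mul (he : IsIdempotentElem e) (ι : DualBimoduleIso K e)
    (hA : IsCornerComplete e A) (μ : DualAlgebra K A) (a b : A) :
    ι.trace (a * ι.canonicalMap he hA μ * b) = μ (b * e * a) :=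
  (ι.exists_trace_eq he hA μ).choose_spec a b

/-- The map `ω` given by the trace form as a `CanonicalHom` of the regular bimodule `A`. -/
noncomputable def canonicalHom (he : IsIdempotentElem e) (ι : DualBimoduleIso K e)
    (hA : IsCornerComplete e A) :
    CanonicalHom (AlgEquiv.refl : Aᵐᵒᵖ ≃ₐ[K] Aᵐᵒᵖ) (1 : A) where
  regular := isRegularBimodule_op A
  hom := ι.canonicalMap he hA
  hom_map r s hrs μ := ι.eq_of_trace he fun a b => by
    obtain rfl : unop r = s := by simpa [MulOpposite.smul_eq_mul_unop] using hrs
    rw [MulOpposite.smul_eq_mul_unop, ← mul_assoc, mul_assoc _ (unop r) b,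
      ι.trace_mul_canonicalMap_mul, ι.trace_mul_canonicalMap_mul, mul_assoc, mul_assoc]
    exact congrArg μ (by simp [mul_assoc])
  bijective := by
    have hsmul (r : Aᵐᵒᵖ) (μ : DualAlgebra K A) (a b : A) :
        ι.trace (a * (r • ι.canonicalMap he hA) μ * b) = μ (unop r * (b * e) * a) := by
      calc ι.trace (a * (ι.canonicalMap he hA μ * unop r) * b)
          = ι.trace (a * ι.canonicalMap he hA μ * (unop r * b)) := by simp only [mul_assoc]
        _ = μ (unop r * (b * e) * a) := by
          rw [ι.trace_mul_canonicalMap_mul, mul_assoc (unop r)]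
    constructor
    · refine fun r r' h => unop_injective (ι.eq_of_trace he fun a b => ?_)
      have hrr' : unop r * (b * e) * 1 = unop r' * (b * e) * 1 :=
        DualModule.eq_of_forall_apply_eq (AlgEquiv.refl : Aᵐᵒᵖ ≃ₐ[K] Aᵐᵒᵖ) fun μ => by
          rw [← hsmul, ← hsmul]
          exact congrArg (fun f => ι.trace (1 * f μ * b)) h
      rw [mul_one, mul_one] at hrr'
      rw [← ι.trace_mul_idem he, mul_assoc, mul_assoc, mul_assoc a, hrr', ← mul_assoc, ← mul_assoc,
        ← mul_assoc, ι.trace_mul_idem he]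
    · intro h
      obtain ⟨c, hc⟩ := ι.exists_trace_hom_eq he hA h
      exact ⟨op c, LinearMap.ext fun μ => ι.eq_of_trace he fun a b => by rw [hc, hsmul, unop_op]⟩

end DualBimoduleIso

end GendoSymmetric

theorem theorem4_general (K A : Type u) [Field K] [Ring A] [Algebra K A] [FiniteDimensional K A]
    (hA : 2 ≤ dominantDimension Aᵐᵒᵖ A) {e : A} (he : IsIdempotentElem e)
    [FaithfulSMul Aᵐᵒᵖ (rightIdeal e)] (ι : DualBimoduleIso K e) (M : Type u) [AddCommGroup M]
    [Module K M] [Module Aᵐᵒᵖ M] [IsScalarTower K Aᵐᵒᵖ M] [FiniteDimensional K M] :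
    IsGorensteinProjectiveInjective K A M ↔
      dominantDimension Aᵐᵒᵖ M = ⊤ ∧ codominantDimension K A M = ⊤ := by
  have hcomplete : IsCornerComplete e A :=
    (ι.isCornerComplete_rightIdeal he).of_two_le_dominantDimension
      (ι.isCornerFaithful_rightIdeal he) hA
  have : FiniteDimensional K Aᵐᵒᵖ := Module.Finite.equiv (opLinearEquiv K)
  have : IsArtinianRing A := isArtinian_of_tower K inferInstance
  have : IsArtinianRing Aᵐᵒᵖ := isArtinian_of_tower K inferInstance
  have : Module.Finite Aᵐᵒᵖ M := .of_restrictScalars_finite K _ _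
  let θ : Aᵐᵒᵖ ≃ₐ[K] Aᵐᵒᵖ := AlgEquiv.refl
  have : Module.Finite A (DualModule θ M) := .of_restrictScalars_finite K _ _
  have hregular := isRegularBimodule_op A
  have hM : IsTotallyReflexive Aᵐᵒᵖ A A M ↔ IsGorensteinProjective A M :=
    hregular.isTotallyReflexive_iff
  have hDM : IsTotallyReflexive A Aᵐᵒᵖ A (DualModule θ M) ↔ IsGorensteinInjective K A M :=
    hregular.symm.isTotallyReflexive_iff
  rw [IsGorensteinProjectiveInjective, ← hM, ← hDM]
  exact (ι.canonicalHom he hcomplete).isTotallyReflexive_and_dual_iff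
    (isQF3_of_two_le_dominantDimension hA)

theorem theorem4 (K A : Type u) [Field K] [Ring A] [Algebra K A] [FiniteDimensional K A]
    (hA : IsGendoSymmetric K A)
    (M : Type u) [AddCommGroup M] [Module K M] [Module Aᵐᵒᵖ M] [IsScalarTower K Aᵐᵒᵖ M]
    [FiniteDimensional K M] :
    IsGorensteinProjectiveInjective K A M ↔
      dominantDimension Aᵐᵒᵖ M = ⊤ ∧ codominantDimension K A M = ⊤ := by
  obtain ⟨e, he, ⟨ι⟩⟩ := hA.exists_iso
  have := he.faithful
  exact theorem4_general K A hA.two_le_dominantDimension he.idempotent ι M
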